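/- Let $d,L\ge 1$ and let $\Omega$ be a compact space with an action $T$ of $\mathbb Z^d$ by homeomorphisms. Consider uniformly bounded families $A=(A_\omega)_{\omega\in\Omega}$ of operators on $\ell^2(\mathbb Z^d,\mathbb C^L)$. Let $\mathcal A_d$ be the C*-algebra (supremum norm) generated by those families that are covariant, $U(a)A_\omega U(a)^*=A_{T^a\omega}$ for $a\in\mathbb Z^d$, have matrix elements depending continuously on $\omega$, and have short range (matrix elements vanish between sites at distance $>R$, for some $R$). Let $\mathcal E_d$ be the C*-algebra generated by the families on the half-space $\ell^2(\mathbb Z^{d-1}\times\mathbb N,\mathbb C^L)$, $\mathbb N=\{1,2,\dots\}$, that are covariant under translations in $\mathbb Z^{d-1}$, continuous in the same sense, of short range and supported in finitely many layers $\mathbb Z^{d-1}\times\{n\}$; let $\mathcal E_d^\sim=\mathbb C\mathbf 1+\mathcal E_d$. In $K_1(\mathcal E_d)$, $[U]_1$ is the class of an invertible (matrix over) $\mathcal E_d^\sim$ up to homotopy of invertibles after enlargement by identity matrices, and $-[U]_1=[U^{-1}]_1$. Let $H_0,H_1\in\mathcal A_d$ be self-adjoint of range $1$ (nearest neighbor),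 with $H_0$ periodic in the $d-1$ directions along the boundary. Suppose that in the block Jacobi form $(H_0\phi)_n=A_{n+1}\phi_{n+1}+B_n\phi_n+A_n^*\phi_{n-1}$, $\phi_n\in\ell^2(\mathbb Z^{d-1},\mathbb C^L)$, every $A_n$ is invertible with inverse bounded uniformly in $\omega$. Let $\mu\in\mathbb R\setminus\sigma(H_0)$ and $N\ge 1$. For real $\lambda$ put $H=H_0+\lambda H_1$, let $\widehat H$ be the restriction of $H$ to the half-space, let $\Pi_{[1,N]}$ be the partial isometry onto $\ell^2(\mathbb Z^{d-1}\times\{1,\dots,N\},\mathbb C^L)$, and put $$\widehat G^z_N=\Pi_{[1,N]}(\widehat H-z)^{-1}\Pi_{[1,N]}^*,\qquad \widehat V^z_N=(\widehat G^z_N-\imath\mathbf 1)(\widehat G^z_N+\imath\mathbf 1)^{-1}.$$ Then there are $\delta_0>0$ and $\lambda_0>0$ such that for all $0<\delta<\delta_0$ and all real $\lambda$ with $|\lambda|<\lambda_0$: $\mu\notin\sigma(H)$; $\widehat G^{\mu+\imath\delta}_N+\imath\mathbf 1$ and $\widehat V^{\mu+\imath\delta}_N$ are invertible with inverses bounded uniformly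 in $\omega$; and for every smooth non-decreasing $f:\mathbb R\to[0,1]$ that is equal to $0$ below and to $1$ above a gap $(a,b)\ni\mu$ of $\sigma(H)$, the operators $\widehat U=e^{2\pi\imath f(\widehat H)}$ and $\widehat V^{\mu+\imath\delta}_N$ (extended by the identity to the layers $n>N$) are invertible elements of $\mathcal E_d^\sim$ and $$[\widehat U]_1=-[\widehat V^{\mu+\imath\delta}_N]_1\quad\text{in }K_1(\mathcal E_d).$$ -/

import Mathlib

open scoped BoundedContinuousFunction

noncomputable section

/-! ### The group `K₁` of a unital topological ring -/

section KTheory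

variable {A : Type*} [Ring A]

/-- The stabilization `U ↦ U ⊕ 1` from `n × n` to `k × k` matrices (used for `n ≤ k`). -/
def stabMatrix {n : ℕ} (k : ℕ) (U : Matrix (Fin n) (Fin n) A) : Matrix (Fin k) (Fin k) A :=
  fun i j => if h : i.1 < n ∧ j.1 < n then U ⟨i.1, h.1⟩ ⟨j.1, h.2⟩ else if i = j then 1 else 0

theorem stabMatrix_one {n : ℕ} (k : ℕ) :
    stabMatrix k (1 : Matrix (Fin n) (Fin n) A) = 1 := by
  ext i j
  by_cases hij : i = j
  · subst hij; simp [stabMatrix]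
  · have : i.1 ≠ j.1 := fun h => hij (Fin.ext h)
    simp [stabMatrix, hij, this]

theorem stabMatrix_mul {n k : ℕ} (hnk : n ≤ k) (U V : Matrix (Fin n) (Fin n) A) :
    stabMatrix k (U * V) = stabMatrix k U * stabMatrix k V := by
  obtain ⟨m, rfl⟩ := Nat.exists_eq_add_of_le hnk
  ext i j
  rw [Matrix.mul_apply, Fin.sum_univ_add]
  by_cases hi : i.1 < n
  · by_cases hj : j.1 < n
    · simp [stabMatrix, hi, hj, Matrix.mul_apply]
      refine Finset.sum_eq_zero fun x _ => ?_
      have : i ≠ Fin.natAdd n x := fun h => by rw [h] at hi; simp at hi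
      simp [this]
    · have h1 : i ≠ j := fun h => hj (h ▸ hi)
      have h2 : ∀ x : Fin n, Fin.castAdd m x ≠ j := fun x h => hj (by rw [← h]; simp)
      have h3 : ∀ x : Fin m, i ≠ Fin.natAdd n x := fun x h => by rw [h] at hi; simp at hi
      simp [stabMatrix, hi, hj, h1, h2, h3]
  · have h2 : ∀ x : Fin n, i ≠ Fin.castAdd m x := fun x h => hi (by rw [h]; simp)
    obtain ⟨i', rfl⟩ : ∃ i' : Fin m, i = Fin.natAdd n i' :=
      ⟨⟨i.1 - n, by omega⟩, Fin.ext (by simp; omega)⟩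
    have h4 : ∀ x : Fin m, (Fin.natAdd n i' = Fin.natAdd n x) ↔ i' = x := fun x => by
      simp [Fin.ext_iff]
    by_cases hj : ∃ j' : Fin m, j = Fin.natAdd n j'
    · obtain ⟨j', rfl⟩ := hj
      simp [stabMatrix, h2]
    · have h5 : ∀ x : Fin m, Fin.natAdd n x ≠ j := fun x h => hj ⟨x, h.symm⟩
      simp [stabMatrix, h2, h5]

theorem stabMatrix_stabMatrix {n k l : ℕ} (hnk : n ≤ k) (U : Matrix (Fin n) (Fin n) A) :
    stabMatrix l (stabMatrix k U) = stabMatrix l U := by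
  ext i j
  simp only [stabMatrix]
  by_cases hi : i.1 < n <;> by_cases hj : j.1 < n <;> by_cases hi' : i.1 < k <;>
    by_cases hj' : j.1 < k <;> simp [hi, hj, hi', hj', Fin.ext_iff] <;> omega

/-- The stabilization `U ↦ U ⊕ 1` as a group homomorphism `GL_n(A) → GL_k(A)` for `n ≤ k`. -/
def stabGL {n k : ℕ} (hnk : n ≤ k) :
    (Matrix (Fin n) (Fin n) A)ˣ →* (Matrix (Fin k) (Fin k) A)ˣ :=
  Units.map
    { toFun := stabMatrix k
      map_one' := stabMatrix_one k
      map_mul' := stabMatrix_mul hnk }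

theorem stabGL_stabGL {n k l : ℕ} (hnk : n ≤ k) (hkl : k ≤ l) (U : (Matrix (Fin n) (Fin n) A)ˣ) :
    stabGL hkl (stabGL hnk U) = stabGL (hnk.trans hkl) U :=
  Units.ext (stabMatrix_stabMatrix hnk U.1)

variable [TopologicalSpace A]

theorem continuous_stabGL {n k : ℕ} (hnk : n ≤ k) :
    Continuous (stabGL hnk : (Matrix (Fin n) (Fin n) A)ˣ → (Matrix (Fin k) (Fin k) A)ˣ) := by
  refine Continuous.units_map _ (continuous_matrix fun i j => ?_)
  by_cases h : i.1 < n ∧ j.1 < n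
  · simpa [stabMatrix, h] using
      (continuous_id (X := Matrix (Fin n) (Fin n) A)).matrix_elem ⟨i.1, h.1⟩ ⟨j.1, h.2⟩
  · simpa [stabMatrix, h] using continuous_const

/-- Two invertible matrices over `A`, of possibly different sizes, are stably homotopic if they are
joined by a continuous path of invertible matrices after both have been enlarged by a unit
matrix to a common size. -/
def StablyHomotopic (U V : Σ n : ℕ, (Matrix (Fin n) (Fin n) A)ˣ) : Prop :=
  ∃ (k : ℕ) (hU : U.1 ≤ k) (hV : V.1 ≤ k), Joined (stabGL hU U.2) (stabGL hV V.2)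

theorem StablyHomotopic.trans {U V W : Σ n : ℕ, (Matrix (Fin n) (Fin n) A)ˣ}
    (h₁ : StablyHomotopic U V) (h₂ : StablyHomotopic V W) : StablyHomotopic U W := by
  obtain ⟨k, hU, hV, h⟩ := h₁
  obtain ⟨l, hV', hW, h'⟩ := h₂
  have key : ∀ {a b : ℕ} (hab : a ≤ b) {X Y : (Matrix (Fin a) (Fin a) A)ˣ}, Joined X Y →
      Joined (stabGL hab X) (stabGL hab Y) := fun hab X Y hXY =>
    ⟨hXY.somePath.map (continuous_stabGL hab)⟩
  refine ⟨max k l, hU.trans (le_max_left _ _), hW.trans (le_max_right _ _), ?_⟩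
  have a := key (le_max_left k l) h
  have b := key (le_max_right k l) h'
  rw [stabGL_stabGL, stabGL_stabGL] at a b
  exact Joined.trans a b

theorem StablyHomotopic.inv {U V : Σ n : ℕ, (Matrix (Fin n) (Fin n) A)ˣ}
    (h : StablyHomotopic U V) : StablyHomotopic ⟨U.1, U.2⁻¹⟩ ⟨V.1, V.2⁻¹⟩ := by
  obtain ⟨k, hU, hV, h⟩ := h
  refine ⟨k, hU, hV, ?_⟩
  rw [map_inv, map_inv]
  exact ⟨h.somePath.map (Units.continuous_iff.2 ⟨Units.continuous_coe_inv, Units.continuous_val⟩)⟩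

variable (A) in
/-- Stable homotopy as an equivalence relation on the invertible matrices over `A`. -/
def stableHomotopySetoid : Setoid (Σ n : ℕ, (Matrix (Fin n) (Fin n) A)ˣ) where
  r := StablyHomotopic
  iseqv :=
    { refl := fun U => ⟨U.1, le_rfl, le_rfl, Joined.refl _⟩
      symm := fun ⟨k, hU, hV, h⟩ => ⟨k, hV, hU, h.symm⟩
      trans := StablyHomotopic.trans }

variable (A) in
/-- `K₁(A)`: invertible matrices over `A` of arbitrary size, up to stable homotopy. -/
def KOne : Type _ := Quotient (stableHomotopySetoid A)

/-- The additive inverse in `K₁(A)`: as the group law is induced by the product (equivalently, by the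
direct sum) of representatives, `-[U]₁ = [U⁻¹]₁`. -/
instance KOne.instNeg : Neg (KOne A) :=
  ⟨Quotient.map' (fun U => ⟨U.1, U.2⁻¹⟩) fun _ _ h => h.inv⟩

/-- The class `[u]₁ ∈ K₁(A)` of an invertible element `u` of `A`, viewed as a `1 × 1` matrix. -/
def KOne.mk (u : Aˣ) : KOne A :=
  Quotient.mk (stableHomotopySetoid A)
    ⟨1, Units.map (Matrix.scalar (Fin 1) : A →+* Matrix (Fin 1) (Fin 1) A).toMonoidHom u⟩

end KTheory

/-! ### Hilbert spaces over sets of sites and families of operators -/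

/-- The Hilbert space `ℓ²(ι, ℂ^L)`. -/
abbrev L2 (ι : Type*) (L : ℕ) : Type _ := lp (fun _ : ι => EuclideanSpace ℂ (Fin L)) 2

/-- Restriction `ℓ²(κ, ℂ^L) → ℓ²(ι, ℂ^L)`, `ψ ↦ ψ ∘ f`, along an injection `f : ι ↪ κ` of sites. It is a
partial isometry, whose adjoint extends by zero. -/
def siteRestrict {ι κ : Type*} (L : ℕ) (f : ι ↪ κ) : L2 κ L →L[ℂ] L2 ι L :=
  LinearMap.mkContinuous
    { toFun := fun ψ => ⟨fun i => ψ (f i), memℓp_gen <| by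
        simpa [Function.comp_def] using
          ((lp.memℓp ψ).summable (by norm_num)).comp_injective f.injective⟩
      map_add' := fun _ _ => rfl
      map_smul' := fun _ _ => rfl }
    1 (fun ψ => by
      have h2 : 0 < (2 : ENNReal).toReal := by norm_num
      rw [one_mul]
      refine lp.norm_le_of_forall_sum_le h2 (norm_nonneg _) fun s => ?_
      have := lp.sum_rpow_le_norm_rpow h2 ψ (s.map f)
      rwa [Finset.sum_map] at this)

/-- The set `Ω` with the discrete topology. -/
def DiscreteCopy (Ω : Type*) : Type _ := Ω

instance (Ω : Type*) : TopologicalSpace (DiscreteCopy Ω) := ⊥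

instance (Ω : Type*) : DiscreteTopology (DiscreteCopy Ω) := ⟨rfl⟩

/-- The C*-algebra of all norm-bounded families `(A_ω)_{ω ∈ Ω}` of bounded operators on
`ℓ²(ι, ℂ^L)`, with pointwise operations and the supremum norm. -/
abbrev OpFamily (Ω ι : Type*) (L : ℕ) : Type _ := DiscreteCopy Ω →ᵇ (L2 ι L →L[ℂ] L2 ι L)

instance (Ω ι : Type*) (L : ℕ) : CStarAlgebra (OpFamily Ω ι L) := inferInstance

instance (Ω ι : Type*) (L : ℕ) : IsTopologicalRing (OpFamily Ω ι L) := inferInstance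

instance (Ω ι : Type*) (L : ℕ) :
    ContinuousFunctionalCalculus ℝ (OpFamily Ω ι L) IsSelfAdjoint :=
  IsSelfAdjoint.instContinuousFunctionalCalculus

/-- The member `A_ω` of a family of operators. -/
def OpFamily.fiber {Ω ι : Type*} {L : ℕ} (A : OpFamily Ω ι L) (ω : Ω) : L2 ι L →L[ℂ] L2 ι L :=
  A (show DiscreteCopy Ω from ω)

/-- The family `(R A_ω S*)_{ω ∈ Ω}`. -/
def OpFamily.sandwich {Ω ι κ : Type*} {L : ℕ} (R S : L2 κ L →L[ℂ] L2 ι L) (A : OpFamily Ω κ L) :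
    OpFamily Ω ι L :=
  BoundedContinuousFunction.ofNormedAddCommGroupDiscrete
    (fun ω => R ∘L A ω ∘L ContinuousLinearMap.adjoint S)
    (‖R‖ * (‖A‖ * ‖ContinuousLinearMap.adjoint S‖)) (fun ω => by
      refine (ContinuousLinearMap.opNorm_comp_le _ _).trans ?_
      gcongr
      refine (ContinuousLinearMap.opNorm_comp_le _ _).trans ?_
      gcongr
      exact A.norm_coe_le_norm ω)

section Entries

variable {Ω ι : Type*} {L : ℕ}

open Classical in
/-- The matrix element `π_n A_ω π_m^*` between the sites `n` and `m`, as a map on `ℂ^L`. -/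
def OpFamily.entry (A : OpFamily Ω ι L) (ω : Ω) (n m : ι) (v : EuclideanSpace ℂ (Fin L)) :
    EuclideanSpace ℂ (Fin L) :=
  A.fiber ω (lp.single 2 m v) n

/-- The matrix elements depend continuously on `ω`. -/
def OpFamily.ContinuousEntries [TopologicalSpace Ω] (A : OpFamily Ω ι L) : Prop :=
  ∀ n m v, Continuous fun ω => A.entry ω n m v

/-- All matrix elements between sites at distance larger than `R` vanish. -/
def OpFamily.HasRange [Dist ι] (A : OpFamily Ω ι L) (R : ℝ) : Prop :=
  ∀ ω n m v, R < dist n m → A.entry ω n m v = 0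

end Entries

/-! ### Bulk, half-space and strip -/

/-- The sites of `ℤ^(d-1)`. -/
abbrev BdrySite (d : ℕ) : Type := Fin (d - 1) → ℤ

/-- The sites of the bulk lattice `ℤ^d = ℤ^(d-1) × ℤ`; distances are measured in the maximum norm. -/
abbrev BulkSite (d : ℕ) : Type := BdrySite d × ℤ

/-- The sites of the half-space `ℤ^(d-1) × {1, 2, …}`; the index `k : ℕ` labels the layer `k + 1`. -/
abbrev HalfSite (d : ℕ) : Type := BdrySite d × ℕ

/-- The sites of the strip `ℤ^(d-1) × {1, …, N}`; the index `k : Fin N` labels the layer `k + 1`. -/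
abbrev StripSite (d N : ℕ) : Type := BdrySite d × Fin N

/-- The inclusion of the layer `ℤ^(d-1) × {n}` in the bulk lattice. -/
def layerIncl (d : ℕ) (n : ℤ) : BdrySite d ↪ BulkSite d :=
  ⟨fun x => (x, n), fun _ _ h => congrArg Prod.fst h⟩

/-- The inclusion of the half-space in the bulk lattice. -/
def halfIncl (d : ℕ) : HalfSite d ↪ BulkSite d :=
  ⟨fun p => (p.1, (p.2 : ℤ) + 1), fun p q h => by
    rcases p with ⟨x, k⟩
    rcases q with ⟨y, l⟩
    simpa using h⟩

/-- The inclusion of the strip in the half-space. -/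
def stripIncl (d N : ℕ) : StripSite d N ↪ HalfSite d :=
  ⟨fun p => (p.1, p.2.1), fun p q h => by
    rcases p with ⟨x, k⟩
    rcases q with ⟨y, l⟩
    simpa [Fin.ext_iff] using h⟩

section Algebras

variable {Ω : Type*} {d L : ℕ}

/-- Covariance `U(a) A_ω U(a)^* = A_{T^a ω}` for all translations `a ∈ ℤ^d`, in matrix elements. -/
def OpFamily.Covariant [AddAction (BulkSite d) Ω] (A : OpFamily Ω (BulkSite d) L) : Prop :=
  ∀ (a : BulkSite d) ω n m v, A.entry (a +ᵥ ω) n m v = A.entry ω (n - a) (m - a) v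

/-- Covariance of half-space operators with respect to the translations `a ∈ ℤ^(d-1)` along the
boundary. -/
def OpFamily.BdryCovariant [AddAction (BulkSite d) Ω] (A : OpFamily Ω (HalfSite d) L) : Prop :=
  ∀ (a : BdrySite d) ω (x y : BdrySite d) (k l : ℕ) v,
    A.entry (((a, 0) : BulkSite d) +ᵥ ω) (x, k) (y, l) v = A.entry ω (x - a, k) (y - a, l) v

/-- The half-space operator is supported in finitely many layers next to the boundary. -/
def OpFamily.StripSupported (A : OpFamily Ω (HalfSite d) L) : Prop :=
  ∃ M : ℕ, ∀ ω (x y : BdrySite d) (k l : ℕ) v,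
    M ≤ k ∨ M ≤ l → A.entry ω (x, k) (y, l) v = 0

variable (Ω d L) in
/-- The C*-algebra `𝒜_d` generated by the covariant (and continuous) families of short range operators
on `ℓ²(ℤ^d, ℂ^L)`. -/
def bulkAlgebra [TopologicalSpace Ω] [AddAction (BulkSite d) Ω] :
    StarSubalgebra ℂ (OpFamily Ω (BulkSite d) L) :=
  (StarAlgebra.adjoin ℂ
    {A | A.Covariant ∧ A.ContinuousEntries ∧ ∃ R : ℝ, A.HasRange R}).topologicalClosure

variable (Ω d L) in
/-- The C*-algebra `ℰ_d ≅ 𝒜_{d-1} ⊗ 𝒦` of edge operators, generated by the families on the half-space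
which are covariant along the boundary, continuous, of short range and supported in finitely many
layers next to the boundary. -/
def edgeAlgebra [TopologicalSpace Ω] [AddAction (BulkSite d) Ω] :
    NonUnitalStarSubalgebra ℂ (OpFamily Ω (HalfSite d) L) :=
  (NonUnitalStarAlgebra.adjoin ℂ
    {A | A.BdryCovariant ∧ A.ContinuousEntries ∧ (∃ R : ℝ, A.HasRange R) ∧
      A.StripSupported}).topologicalClosure

variable (Ω d L) in
/-- The unitization `ℰ_d^~ = ℂ 1 + ℰ_d` of the edge algebra. -/
def edgeUnitization [TopologicalSpace Ω] [AddAction (BulkSite d) Ω] :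
    StarSubalgebra ℂ (OpFamily Ω (HalfSite d) L) :=
  StarAlgebra.adjoin ℂ (edgeAlgebra Ω d L : Set (OpFamily Ω (HalfSite d) L))

/-! ### Hamiltonians, Green matrices and their Cayley transforms -/

/-- `H` is periodic, with some period `p ≥ 1`, in the `d - 1` directions along the boundary. -/
def OpFamily.PeriodicAlongBdry (H : OpFamily Ω (BulkSite d) L) : Prop :=
  ∃ p : ℕ, 0 < p ∧ ∀ (a : BdrySite d) ω n m v,
    H.entry ω (n + (p • a, 0)) (m + (p • a, 0)) v = H.entry ω n m v

/-- The coefficient `A_{n+1}` of `φ_{n+1}` in the block Jacobi form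
`(H φ)_n = A_{n+1} φ_{n+1} + B_n φ_n + A_n^* φ_{n-1}`, as a family of operators on `ℓ²(ℤ^(d-1), ℂ^L)`. -/
def OpFamily.hopping (H : OpFamily Ω (BulkSite d) L) (n : ℤ) : OpFamily Ω (BdrySite d) L :=
  H.sandwich (siteRestrict L (layerIncl d n)) (siteRestrict L (layerIncl d (n + 1)))

/-- The half-space restriction `Ĥ` of `H`. -/
def OpFamily.half (H : OpFamily Ω (BulkSite d) L) : OpFamily Ω (HalfSite d) L :=
  H.sandwich (siteRestrict L (halfIncl d)) (siteRestrict L (halfIncl d))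

/-- The Green matrix `Ĝ^z_N = Π_{[1,N]} (Ĥ - z)⁻¹ Π_{[1,N]}^*` on the strip of width `N`. -/
def greenMatrix (H : OpFamily Ω (BulkSite d) L) (N : ℕ) (z : ℂ) : OpFamily Ω (StripSite d N) L :=
  (Ring.inverse (H.half - z • 1)).sandwich
    (siteRestrict L (stripIncl d N)) (siteRestrict L (stripIncl d N))

/-- The Cayley transform `V̂^z_N = (Ĝ^z_N - i) (Ĝ^z_N + i)⁻¹`. -/
def cayleyGreen (H : OpFamily Ω (BulkSite d) L) (N : ℕ) (z : ℂ) : OpFamily Ω (StripSite d N) L :=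
  (greenMatrix H N z - Complex.I • 1) * Ring.inverse (greenMatrix H N z + Complex.I • 1)

/-- The half-space operator `V ⊕ 1` equal to `V` on the strip and to the identity on the remaining
layers, that is, `1 + Π_{[1,N]}^* (V - 1) Π_{[1,N]}`. -/
def stripExtend {N : ℕ} (V : OpFamily Ω (StripSite d N) L) : OpFamily Ω (HalfSite d) L :=
  1 + (V - 1).sandwich
    (ContinuousLinearMap.adjoint (siteRestrict L (stripIncl d N)))
    (ContinuousLinearMap.adjoint (siteRestrict L (stripIncl d N)))

/-- `f` is smooth, non-decreasing, `0` below and `1` above a gap `(a, b) ∋ μ` of the spectrum of `H`. -/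
def IsGapSwitch (H : OpFamily Ω (BulkSite d) L) (μ : ℝ) (f : ℝ → ℝ) : Prop :=
  ContDiff ℝ (⊤ : ℕ∞) f ∧ Monotone f ∧ ∃ a b : ℝ, a < μ ∧ μ < b ∧
    (∀ E ∈ Set.Ioo a b, (E : ℂ) ∉ spectrum ℂ H) ∧ (∀ E ≤ a, f E = 0) ∧ (∀ E ≥ b, f E = 1)

/-- The operator `Û = exp(2πi f(Ĥ))`. -/
def expBoundary (H : OpFamily Ω (BulkSite d) L) (f : ℝ → ℝ) : OpFamily Ω (HalfSite d) L :=
  NormedSpace.exp ((2 * Real.pi * Complex.I : ℂ) • cfc f H.half)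

end Algebras

end

noncomputable section

/-! ### Homotopies of units in the unitization of an ideal -/

section Ideal

variable {B : Type*} [CStarAlgebra B] (E : NonUnitalStarSubalgebra ℂ B)

/-! Write `h` for the half-space operator, `p` for the projection onto the strip, `z = μ + iδ`, `r =
(h - z)⁻¹` and `E` for the edge algebra. All classes are represented by quotients `x y⁻¹` with `x`,
`y` invertible, `y` a multiplier of `E` and `x - y ∈ E`. Such a quotient lies in `1 + E`, and a
continuous path of such pairs is a homotopy of invertibles in the unitization
(`edgeHomotopic_of_path`).

The extended Cayley transform is `(1 - p + prp - ip)(1 - p + prp + ip)⁻¹`. Rotating the phases `∓i`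
to `1` and deforming `prp` to `rp` gives `(1 + irp)(1 - irp)⁻¹`. Since `1 ± irp = r(h - z ± ip)`, a
deformation of `r` to a scalar leaves `(h - z + ip)(h - z - ip)⁻¹`. Now `δ` is sent to `0` and `p`
is replaced by `χ(h)`, where `χ` is a parabola over the gap. From there on everything is a function
of `h`: both `x - μ + iχ(x)` and `-exp(-iπ f(x))` take values in the closed upper half-plane and,
off the gap, are real and of the same sign, so the segment between them avoids `0`. The second
function divided by its conjugate is `exp(-2πi f)`, which gives the inverse of `exp(2πi f(h))`
(`exists_kOne_exp_eq_neg_cayley`).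

Two facts tie this to the bulk. Compression to the half-space is multiplicative modulo `E`, so a
function vanishing on the bulk spectrum sends `h` into `E` (`lineCfc_half_mem`). And `x + iQ` with
`x` self-adjoint and `Q ≥ 0` is invertible once `x² + Q ≥ c > 0` (`isUnit_add_I_smul`). For `Q = p`
this bound holds because a vector vanishing on the strip, extended by zero, is not carried across
the boundary by a nearest neighbor `H`, so that the bulk gap bounds it from below
(`exists_norm_le_strip`). -/

/-- The largest star subalgebra of `B` in which `E` is a two-sided ideal. -/
def NonUnitalStarSubalgebra.idealizer : StarSubalgebra ℂ B where
  carrier := {b | ∀ e ∈ E, b * e ∈ E ∧ e * b ∈ E}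
  mul_mem' {a b} ha hb e he :=
    ⟨by rw [mul_assoc]; exact (ha _ (hb e he).1).1, by rw [← mul_assoc]; exact (hb _ (ha e he).2).2⟩
  add_mem' {a b} ha hb e he :=
    ⟨by rw [add_mul]; exact add_mem (ha e he).1 (hb e he).1,
      by rw [mul_add]; exact add_mem (ha e he).2 (hb e he).2⟩
  algebraMap_mem' r e he := by
    simp only [Algebra.algebraMap_eq_smul_one, smul_mul_assoc, one_mul, mul_smul_comm, mul_one]
    exact ⟨SMulMemClass.smul_mem r he, SMulMemClass.smul_mem r he⟩
  star_mem' {a} ha e he := by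
    have h := ha (star e) (star_mem he)
    constructor
    · simpa using star_mem h.2
    · simpa using star_mem h.1

variable {E}

theorem NonUnitalStarSubalgebra.le_idealizer {e : B} (he : e ∈ E) : e ∈ E.idealizer :=
  fun _ he' => ⟨mul_mem he he', mul_mem he' he⟩

theorem NonUnitalStarSubalgebra.isClosed_idealizer (hE : IsClosed (E : Set B)) :
    IsClosed (E.idealizer : Set B) := by
  have : (E.idealizer : Set B) = ⋂ e ∈ E, {b | b * e ∈ E} ∩ {b | e * b ∈ E} := by
    ext b
    simp [NonUnitalStarSubalgebra.idealizer]
  rw [this]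
  refine isClosed_biInter fun e _ => IsClosed.inter ?_ ?_
  · exact hE.preimage (continuous_mul_const e)
  · exact hE.preimage (continuous_const_mul e)

/-- Spectral permanence for C*-subalgebras: inverses taken in `B` do not leave a closed star
subalgebra. Applied to the idealizer, it makes resolvents multipliers of `E`. -/
theorem StarSubalgebra.ringInverse_mem {S : StarSubalgebra ℂ B} (hS : IsClosed (S : Set B))
    {x : B} (hx : x ∈ S) (hu : IsUnit x) : Ring.inverse x ∈ S := by
  have : IsClosed (S : Set B) := hS
  obtain ⟨u, hu'⟩ := (StarSubalgebra.coe_isUnit S (a := ⟨x, hx⟩)).1 hu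
  have h1 : x * (u⁻¹ : Sˣ).1.1 = 1 := by
    have := congrArg Subtype.val u.mul_inv
    rwa [hu'] at this
  have : Ring.inverse x = (u⁻¹ : Sˣ).1.1 := by
    calc _ = Ring.inverse x * (x * (u⁻¹ : Sˣ).1.1) := by rw [h1, mul_one]
      _ = _ := Ring.inverse_mul_cancel_left _ _ hu
  rw [this]
  exact (u⁻¹ : Sˣ).1.2

variable (E) in
/-- Two elements of `B` are edge homotopic if they are invertible elements of `ℂ 1 + E`, joined by a
path of such elements. -/
def EdgeHomotopic (u v : B) : Prop :=
  ∃ U V : (StarAlgebra.adjoin ℂ (E : Set B))ˣ, (U : B) = u ∧ (V : B) = v ∧ Joined U V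

theorem EdgeHomotopic.trans {u v w : B} (h : EdgeHomotopic E u v) (h' : EdgeHomotopic E v w) :
    EdgeHomotopic E u w := by
  obtain ⟨U, V, hU, hV, hj⟩ := h
  obtain ⟨V', W, hV', hW, hj'⟩ := h'
  obtain rfl : V = V' := Units.ext (Subtype.ext (hV.trans hV'.symm))
  exact ⟨U, W, hU, hW, hj.trans hj'⟩

theorem EdgeHomotopic.symm {u v : B} (h : EdgeHomotopic E u v) : EdgeHomotopic E v u := by
  obtain ⟨U, V, hU, hV, hj⟩ := h
  exact ⟨V, U, hV, hU, hj.symm⟩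

theorem mem_adjoin_of_sub_one_mem {u : B} (h : u - 1 ∈ E) :
    u ∈ StarAlgebra.adjoin ℂ (E : Set B) := by
  have := add_mem (StarAlgebra.subset_adjoin ℂ (E : Set B) h) (one_mem _)
  simpa using this

theorem ringInverse_sub_one_mem (hE : IsClosed (E : Set B)) {u : B} (hu : IsUnit u)
    (hM : u ∈ E.idealizer) (h : u - 1 ∈ E) : Ring.inverse u - 1 ∈ E := by
  have h1 := (StarSubalgebra.ringInverse_mem (E.isClosed_idealizer hE) hM hu _ h).1
  rw [mul_sub, Ring.inverse_mul_cancel _ hu, mul_one] at h1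
  simpa using neg_mem h1

theorem mul_sub_one_mem {x y : B} (hy : y ∈ E.idealizer)
    (hx1 : x - 1 ∈ E) (hy1 : y - 1 ∈ E) : x * y - 1 ∈ E := by
  have : x * y - 1 = (x - 1) * y + (y - 1) := by noncomm_ring
  rw [this]
  exact add_mem (hy _ hx1).2 hy1

theorem mem_idealizer_of_sub_one_mem {u : B} (h : u - 1 ∈ E) : u ∈ E.idealizer := by
  have := add_mem (E.le_idealizer h) (one_mem _)
  simpa using this

/-- The difference is `(x - y) y⁻¹`, and `y⁻¹` is again a multiplier of `E`. -/
theorem mul_ringInverse_sub_one_mem (hE : IsClosed (E : Set B)) {x y : B} (hy : IsUnit y)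
    (hyM : y ∈ E.idealizer) (hxy : x - y ∈ E) : x * Ring.inverse y - 1 ∈ E := by
  have h1 := (StarSubalgebra.ringInverse_mem (E.isClosed_idealizer hE) hyM hy _ hxy).2
  rwa [sub_mul, Ring.mul_inverse_cancel _ hy] at h1

/-- An invertible element of `1 + E`, as an invertible element of `ℂ 1 + E`. -/
def unitOfSubOneMem (hE : IsClosed (E : Set B)) {u : B} (hu : IsUnit u) (h : u - 1 ∈ E) :
    (StarAlgebra.adjoin ℂ (E : Set B))ˣ where
  val := ⟨u, mem_adjoin_of_sub_one_mem h⟩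
  inv := ⟨Ring.inverse u, mem_adjoin_of_sub_one_mem
    (ringInverse_sub_one_mem hE hu (mem_idealizer_of_sub_one_mem h) h)⟩
  val_inv := Subtype.ext (Ring.mul_inverse_cancel _ hu)
  inv_val := Subtype.ext (Ring.inverse_mul_cancel _ hu)

/-- The path `t ↦ x_t y_t⁻¹` connects its end points if `x_t - y_t ∈ E` for all `t`. -/
theorem edgeHomotopic_of_path (hE : IsClosed (E : Set B)) {x y : ℝ → B}
    (hxc : ContinuousOn x (Set.Icc 0 1)) (hyc : ContinuousOn y (Set.Icc 0 1))
    (hx : ∀ t ∈ Set.Icc (0 : ℝ) 1, IsUnit (x t)) (hy : ∀ t ∈ Set.Icc (0 : ℝ) 1, IsUnit (y t))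
    (hyM : ∀ t ∈ Set.Icc (0 : ℝ) 1, y t ∈ E.idealizer)
    (hxy : ∀ t ∈ Set.Icc (0 : ℝ) 1, x t - y t ∈ E) :
    EdgeHomotopic E (x 0 * Ring.inverse (y 0)) (x 1 * Ring.inverse (y 1)) := by
  have hinv : ∀ {z : unitInterval → B}, Continuous z → (∀ t, IsUnit (z t)) →
      Continuous fun t => Ring.inverse (z t) := fun {z} hz hu =>
    continuous_iff_continuousAt.2 fun t => by
      obtain ⟨u, hu⟩ := hu t
      have := NormedRing.inverse_continuousAt u
      rw [hu] at this
      exact ContinuousAt.comp (f := z) this hz.continuousAt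
  have hxc' : Continuous fun t : unitInterval => x t := hxc.domRestrict
  have hyc' : Continuous fun t : unitInterval => y t := hyc.domRestrict
  have hγc : Continuous fun t : unitInterval => x t * Ring.inverse (y t) :=
    hxc'.mul (hinv hyc' fun t => hy t t.2)
  have hγu : ∀ t : unitInterval, IsUnit (x t * Ring.inverse (y t)) := fun t =>
    (hx t t.2).mul ((hy t t.2).ringInverse)
  have hγE : ∀ t : unitInterval, x t * Ring.inverse (y t) - 1 ∈ E := fun t =>
    mul_ringInverse_sub_one_mem hE (hy t t.2) (hyM t t.2) (hxy t t.2)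
  refine ⟨unitOfSubOneMem hE (hγu 0) (hγE 0), unitOfSubOneMem hE (hγu 1) (hγE 1), rfl, rfl, ⟨?_⟩⟩
  refine ⟨⟨fun t => unitOfSubOneMem hE (hγu t) (hγE t), ?_⟩, rfl, rfl⟩
  -- The topology of the unit group also asks for continuity of the inverses.
  refine Units.continuous_iff.2 ⟨?_, ?_⟩
  · exact hγc.subtype_mk _
  · exact (hinv hγc hγu).subtype_mk _

theorem KOne.mk_eq_mk_of_joined {A : Type*} [Ring A] [TopologicalSpace A] {U V : Aˣ}
    (h : Joined U V) : KOne.mk U = KOne.mk V := by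
  refine Quotient.sound ⟨1, le_rfl, le_rfl, ⟨h.somePath.map (f := fun W => stabGL (le_refl 1)
    (Units.map (Matrix.scalar (Fin 1) : A →+* Matrix (Fin 1) (Fin 1) A).toMonoidHom W)) ?_⟩⟩
  refine (continuous_stabGL _).comp (Continuous.units_map _ ?_)
  exact continuous_matrix fun i j => by
    obtain rfl : i = j := Subsingleton.elim _ _
    simpa using continuous_id'

theorem KOne.neg_mk {A : Type*} [Ring A] [TopologicalSpace A] (U : Aˣ) :
    -KOne.mk U = KOne.mk U⁻¹ := by
  refine congrArg (Quotient.mk _) ?_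
  change (⟨1, _⟩ : Σ n : ℕ, (Matrix (Fin n) (Fin n) A)ˣ) = ⟨1, _⟩
  rw [map_inv]

theorem EdgeHomotopic.exists_kOne_eq_neg {u v w : B} (h : EdgeHomotopic E v w) (hwu : w * u = 1) :
    ∃ U V : (StarAlgebra.adjoin ℂ (E : Set B))ˣ, (U : B) = u ∧ (V : B) = v ∧
      KOne.mk U = -KOne.mk V := by
  obtain ⟨V, W, hV, hW, hj⟩ := h
  refine ⟨W⁻¹, V, ?_, hV, ?_⟩
  · have : (W⁻¹).1.1 * W.1.1 = 1 := congrArg Subtype.val W.inv_mul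
    rw [hW] at this
    exact left_inv_eq_right_inv this hwu
  · rw [KOne.mk_eq_mk_of_joined hj, KOne.neg_mk]

end Ideal

/-! ### Homotopies from the Cayley transform on the strip to a quotient in `h - z` -/

section Chain
variable {B : Type*} [CStarAlgebra B] {E : NonUnitalStarSubalgebra ℂ B}

/-- The inverse is `1 - b (1 + ab)⁻¹ a`. This moves `p` from one side of a resolvent to the other.
-/
theorem isUnit_one_add_mul_comm {R : Type*} [Ring R] {a b : R} (h : IsUnit (1 + a * b)) :
    IsUnit (1 + b * a) := by
  obtain ⟨u, hu⟩ := h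
  have h1 : (1 + a * b) * (u⁻¹ : Rˣ).1 = 1 := by rw [← hu]; exact u.mul_inv
  have h2 : (u⁻¹ : Rˣ).1 * (1 + a * b) = 1 := by rw [← hu]; exact u.inv_mul
  refine ⟨⟨1 + b * a, 1 - b * (u⁻¹ : Rˣ).1 * a, ?_, ?_⟩, rfl⟩
  · have : (1 + b * a) * (1 - b * (u⁻¹ : Rˣ).1 * a) =
        1 + b * a - b * ((1 + a * b) * (u⁻¹ : Rˣ).1) * a := by noncomm_ring
    rw [this, h1]; noncomm_ring
  · have : (1 - b * (u⁻¹ : Rˣ).1 * a) * (1 + b * a) =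
        1 + b * a - b * ((u⁻¹ : Rˣ).1 * (1 + a * b)) * a := by noncomm_ring
    rw [this, h2]; noncomm_ring

theorem IsSelfAdjoint.isUnit_sub_smul_one {a : B} (ha : IsSelfAdjoint a) {z : ℂ} (hz : z.im ≠ 0) :
    IsUnit (a - z • (1 : B)) := by
  by_contra h
  refine hz (ha.im_eq_zero_of_mem_spectrum (z := z) ?_)
  rw [spectrum.mem_iff, Algebra.algebraMap_eq_smul_one]
  rwa [← neg_sub, IsUnit.neg_iff] at h

/-- A common right factor cancels in the quotient; it removes the scalar left over at the end of the
path in `edgeHomotopic_conj`. -/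
theorem mul_ringInverse_eq_of_mul_eq {R : Type*} [Ring R] {x y c x' y' : R} (hc : IsUnit c)
    (hy : IsUnit y) (hx' : x' = x * c) (hy' : y' = y * c) :
    x' * Ring.inverse y' = x * Ring.inverse y := by
  symm
  rw [Ring.eq_mul_inverse_iff_mul_eq _ _ _ (hy' ▸ hy.mul hc), hx', hy', ← mul_assoc,
    Ring.inverse_mul_cancel_right _ _ hy]

/-- For a projection `p` and `c ≠ 0`, the element `1 - p + c p` is invertible. -/
theorem isUnit_one_sub_add_smul {p : B} (hp : IsIdempotentElem p) {c : ℂ} (hc : c ≠ 0) :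
    IsUnit (1 - p + c • p) := by
  have key : ∀ c d : ℂ, c * d = 1 → (1 - p + c • p) * (1 - p + d • p) = 1 := fun c d h => by
    simp only [add_mul, mul_add, sub_mul, mul_sub, one_mul, mul_one, smul_mul_assoc, mul_smul_comm,
      hp.eq]
    linear_combination (norm := module) h • p
  exact ⟨⟨_, _, key c c⁻¹ (mul_inv_cancel₀ hc), key c⁻¹ c (inv_mul_cancel₀ hc)⟩, rfl⟩

theorem one_sub_add_smul_mul {p g : B} (hgp : p * g = g) {c d : ℂ} (hcd : c * d = -1) :
    (1 - p + c • p) * (1 - d • g) = 1 - p + g + c • p := by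
  simp only [add_mul, mul_sub, sub_mul, one_mul, mul_one, smul_mul_assoc, mul_smul_comm, hgp]
  linear_combination (norm := module) (-hcd) • g

variable (hE : IsClosed (E : Set B)) {h p : B} (hsa : IsSelfAdjoint h) (hM : h ∈ E.idealizer)
  (hp : IsIdempotentElem p) (hpE : p ∈ E)

include hE hp hpE in
/-- Removing the phases `∓ i` on the strip. -/
theorem edgeHomotopic_cayley_phase {g : B} (hg : g ∈ E) (hgp : p * g = g)
    (h1 : IsUnit (1 + Complex.I • g)) (h2 : IsUnit (1 - Complex.I • g)) :
    EdgeHomotopic E ((1 - p + g - Complex.I • p) * Ring.inverse (1 - p + g + Complex.I • p))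
      ((1 + Complex.I • g) * Ring.inverse (1 - Complex.I • g)) := by
  have hne : ∀ w : ℂ, Complex.exp w ≠ 0 := Complex.exp_ne_zero
  have hphE : ∀ c : ℂ, (1 - p + c • p) - 1 ∈ E := fun c => by
    have : (1 - p + c • p) - 1 = (c - 1) • p := by module
    rw [this]
    exact SMulMemClass.smul_mem _ hpE
  have hgE : (1 + Complex.I • g) - 1 ∈ E := by
    simpa using SMulMemClass.smul_mem Complex.I hg
  have hgE' : (1 - Complex.I • g) - 1 ∈ E := by
    have := SMulMemClass.smul_mem (-Complex.I) hg
    simpa [sub_eq_add_neg] using this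
  -- At `t = 0` the phases are `∓i`, and `(1 - p ∓ ip)(1 ± ig) = 1 - p + g ∓ ip` because `p g = g`.
  -- At `t = 1` both phases are `1`.
  have key := edgeHomotopic_of_path hE
    (x := fun t => (1 - p + Complex.exp (-(Real.pi / 2 * Complex.I) * (1 - t)) • p) *
      (1 + Complex.I • g))
    (y := fun t => (1 - p + Complex.exp (Real.pi / 2 * Complex.I * (1 - t)) • p) *
      (1 - Complex.I • g))
    (by fun_prop) (by fun_prop)
    (fun t _ => (isUnit_one_sub_add_smul hp (hne _)).mul h1)
    (fun t _ => (isUnit_one_sub_add_smul hp (hne _)).mul h2)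
    (fun t _ => mul_mem (mem_idealizer_of_sub_one_mem (hphE _)) (mem_idealizer_of_sub_one_mem hgE'))
    (fun t _ => by
      have a := mul_sub_one_mem (mem_idealizer_of_sub_one_mem hgE)
        (hphE (Complex.exp (-(Real.pi / 2 * Complex.I) * (1 - t)))) hgE
      have b := mul_sub_one_mem (mem_idealizer_of_sub_one_mem hgE')
        (hphE (Complex.exp (Real.pi / 2 * Complex.I * (1 - t)))) hgE'
      simpa using sub_mem a b)
  have e1 : Complex.exp (-(Real.pi / 2 * Complex.I)) = -Complex.I := by
    rw [Complex.exp_neg, Complex.exp_pi_div_two_mul_I, Complex.inv_I]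
  have e2 : (1 - p + (-Complex.I) • p) * (1 + Complex.I • g) = 1 - p + g - Complex.I • p := by
    have := one_sub_add_smul_mul hgp (c := -Complex.I) (d := -Complex.I) (by simp)
    simpa [sub_eq_add_neg] using this
  have e3 := one_sub_add_smul_mul hgp Complex.I_mul_I
  simp only [Complex.ofReal_zero, sub_zero, mul_one, Complex.ofReal_one, sub_self, mul_zero,
    Complex.exp_zero, one_smul, sub_add_cancel, one_mul, e1, Complex.exp_pi_div_two_mul_I,
    e2, e3] at key
  exact key

include hE hp hpE in
/-- From `p R p` to `R p`. -/
theorem edgeHomotopic_compress {r : B} (hr : r ∈ E.idealizer)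
    (h1 : IsUnit (1 + Complex.I • (r * p))) (h2 : IsUnit (1 - Complex.I • (r * p))) :
    EdgeHomotopic E
      ((1 + Complex.I • (p * r * p)) * Ring.inverse (1 - Complex.I • (p * r * p)))
      ((1 + Complex.I • (r * p)) * Ring.inverse (1 - Complex.I • (r * p))) := by
  -- With `q = p + t(1 - p)` one has `p q = p`, so after exchanging the factors `1 + c q r p`
  -- becomes `1 + c p r`, which does not depend on `t`.
  have unit : ∀ c : ℂ, IsUnit (1 + c • (r * p)) → ∀ t : ℂ,
      IsUnit (1 + c • ((p + t • (1 - p)) * r * p)) := fun c hc t => by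
    have hpp : p * (p + t • (1 - p)) = p := by
      simp [mul_add, mul_sub, hp.eq]
    have a : IsUnit (1 + p * (c • r)) := isUnit_one_add_mul_comm (by simpa using hc)
    have b : IsUnit (1 + p * (c • ((p + t • (1 - p)) * r))) := by
      rwa [mul_smul_comm, ← mul_assoc, hpp, ← mul_smul_comm]
    simpa using isUnit_one_add_mul_comm b
  have memE : ∀ t : ℂ, (p + t • (1 - p)) * r * p ∈ E := fun t =>
    ((mul_mem (add_mem (E.le_idealizer hpE) (SMulMemClass.smul_mem t
      (sub_mem (one_mem _) (E.le_idealizer hpE)))) hr) _ hpE).1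
  have key := edgeHomotopic_of_path hE
    (x := fun t => 1 + Complex.I • ((p + (t : ℂ) • (1 - p)) * r * p))
    (y := fun t => 1 - Complex.I • ((p + (t : ℂ) • (1 - p)) * r * p))
    (by fun_prop) (by fun_prop)
    (fun t _ => unit _ h1 _)
    (fun t _ => by
      have := unit (-Complex.I) (by simpa [sub_eq_add_neg] using h2) t
      simpa [sub_eq_add_neg] using this)
    (fun t _ => sub_mem (one_mem _) (SMulMemClass.smul_mem _ (E.le_idealizer (memE _))))
    (fun t _ => by
      have := SMulMemClass.smul_mem (2 * Complex.I) (memE t)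
      convert this using 1
      module)
  simpa using key

include hE hsa hM in
/-- Conjugation by `h - z` is connected to the identity. -/
theorem edgeHomotopic_conj {z : ℂ} (hz : 0 < z.im) {x y : B} (hx : IsUnit x) (hy : IsUnit y)
    (hyM : y ∈ E.idealizer) (hxy : x - y ∈ E) :
    EdgeHomotopic E (Ring.inverse (h - z • 1) * x * Ring.inverse (Ring.inverse (h - z • 1) * y))
      (x * Ring.inverse y) := by
  -- The operator is scaled down while the energy moves to `i` inside the upper half-plane, so the
  -- resolvent exists throughout and ends at the scalar `(-i)⁻¹ = i`.
  have hcu : ∀ t ∈ Set.Icc (0 : ℝ) 1,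
      IsUnit (((1 - t : ℝ) : ℂ) • h - ((1 - t : ℝ) * z + t * Complex.I) • (1 : B)) := fun t ht => by
    refine IsSelfAdjoint.isUnit_sub_smul_one (a := ((1 - t : ℝ) : ℂ) • h) ?_ ?_
    · exact IsSelfAdjoint.smul (by simp [isSelfAdjoint_iff]) hsa
    · have : ((1 - t : ℝ) * z + t * Complex.I).im = (1 - t) * z.im + t := by simp
      rw [this]
      obtain ⟨h0, h1⟩ := ht
      rcases eq_or_lt_of_le h1 with rfl | h1
      · simp
      · have := mul_pos (sub_pos.2 h1) hz
        linarith
  have hcM : ∀ t : ℝ, ((1 - t : ℝ) : ℂ) • h - ((1 - t : ℝ) * z + t * Complex.I) • (1 : B) ∈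
      E.idealizer := fun t => sub_mem (SMulMemClass.smul_mem _ hM)
        (SMulMemClass.smul_mem _ (one_mem _))
  have hcc : ContinuousOn (fun t : ℝ => Ring.inverse
      (((1 - t : ℝ) : ℂ) • h - ((1 - t : ℝ) * z + t * Complex.I) • (1 : B))) (Set.Icc 0 1) :=
    fun t ht => by
      obtain ⟨u, hu⟩ := hcu t ht
      have := NormedRing.inverse_continuousAt u
      rw [hu] at this
      refine ContinuousAt.continuousWithinAt (ContinuousAt.comp (f := fun t : ℝ =>
        ((1 - t : ℝ) : ℂ) • h - ((1 - t : ℝ) * z + t * Complex.I) • (1 : B)) this ?_)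
      exact Continuous.continuousAt (by fun_prop)
  have hcl := E.isClosed_idealizer hE
  have key := edgeHomotopic_of_path hE
    (x := fun t => Ring.inverse
      (((1 - t : ℝ) : ℂ) • h - ((1 - t : ℝ) * z + t * Complex.I) • (1 : B)) * x)
    (y := fun t => Ring.inverse
      (((1 - t : ℝ) : ℂ) • h - ((1 - t : ℝ) * z + t * Complex.I) • (1 : B)) * y)
    (hcc.mul continuousOn_const) (hcc.mul continuousOn_const)
    (fun t ht => (hcu t ht).ringInverse.mul hx)
    (fun t ht => (hcu t ht).ringInverse.mul hy)
    (fun t ht => mul_mem (StarSubalgebra.ringInverse_mem hcl (hcM t) (hcu t ht)) hyM)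
    (fun t ht => by
      rw [← mul_sub]
      exact (StarSubalgebra.ringInverse_mem hcl (hcM t) (hcu t ht) _ hxy).1)
  simp only [sub_zero, Complex.ofReal_one, one_smul, one_mul, Complex.ofReal_zero, zero_mul,
    add_zero, sub_self, zero_smul, zero_add, zero_sub] at key
  have hI : Ring.inverse (-(Complex.I • (1 : B))) = Complex.I • 1 :=
    Ring.inverse_unit ⟨-(Complex.I • (1 : B)), Complex.I • 1, by simp [smul_smul],
      by simp [smul_smul]⟩
  have hIu : IsUnit (Complex.I • (1 : B)) :=
    ⟨⟨Complex.I • 1, -(Complex.I • 1), by simp [smul_smul], by simp [smul_smul]⟩, rfl⟩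
  rw [hI] at key
  rwa [mul_ringInverse_eq_of_mul_eq (x := x) (y := y) (x' := Complex.I • 1 * x)
    (y' := Complex.I • 1 * y) (c := Complex.I • (1 : B)) hIu hy (by simp) (by simp)] at key

end Chain

/-! ### Homotopies in the energy and in the imaginary part -/

section Chain
variable {B : Type*} [CStarAlgebra B] {E : NonUnitalStarSubalgebra ℂ B}
  (hE : IsClosed (E : Set B)) {h p : B} (hM : h ∈ E.idealizer)
  (hpE : p ∈ E)

include hE in
/-- A convex combination `x_t` of invertible elements with `x_t - x_t^* ∈ E`. -/
theorem edgeHomotopic_convex {x y : B} (hx : x ∈ E.idealizer) (hy : y ∈ E.idealizer)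
    (hxE : x - star x ∈ E) (hyE : y - star y ∈ E)
    (hu : ∀ t ∈ Set.Icc (0 : ℝ) 1, IsUnit (((1 - t : ℝ) : ℂ) • x + (t : ℂ) • y)) :
    EdgeHomotopic E (x * Ring.inverse (star x)) (y * Ring.inverse (star y)) := by
  have hst : ∀ t : ℝ, star (((1 - t : ℝ) : ℂ) • x + (t : ℂ) • y) =
      ((1 - t : ℝ) : ℂ) • star x + (t : ℂ) • star y := fun t => by
    simp [star_add, star_smul]
  have key := edgeHomotopic_of_path hE
    (x := fun t => ((1 - t : ℝ) : ℂ) • x + (t : ℂ) • y)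
    (y := fun t => star (((1 - t : ℝ) : ℂ) • x + (t : ℂ) • y))
    (by fun_prop) (by fun_prop) hu (fun t ht => (hu t ht).star)
    (fun t _ => star_mem (add_mem (SMulMemClass.smul_mem _ hx) (SMulMemClass.smul_mem _ hy)))
    (fun t _ => by
      have := add_mem (SMulMemClass.smul_mem ((1 - t : ℝ) : ℂ) hxE)
        (SMulMemClass.smul_mem (t : ℂ) hyE)
      rw [hst]
      convert this using 1
      module)
  simpa using key

include hE hM hpE in
/-- Letting the imaginary part `δ` of the energy go to zero. -/
theorem edgeHomotopic_energy (μ δ : ℝ)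
    (hx : ∀ t ∈ Set.Icc (0 : ℝ) 1,
      IsUnit (h - (μ + (t * δ : ℝ) * Complex.I : ℂ) • 1 + Complex.I • p))
    (hy : ∀ t ∈ Set.Icc (0 : ℝ) 1,
      IsUnit (h - (μ + (t * δ : ℝ) * Complex.I : ℂ) • 1 - Complex.I • p)) :
    EdgeHomotopic E
      ((h - (μ + δ * Complex.I : ℂ) • 1 + Complex.I • p) *
        Ring.inverse (h - (μ + δ * Complex.I : ℂ) • 1 - Complex.I • p))
      ((h - (μ : ℂ) • 1 + Complex.I • p) * Ring.inverse (h - (μ : ℂ) • 1 - Complex.I • p)) := by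
  have key := edgeHomotopic_of_path hE
    (x := fun t => h - (μ + (t * δ : ℝ) * Complex.I : ℂ) • 1 + Complex.I • p)
    (y := fun t => h - (μ + (t * δ : ℝ) * Complex.I : ℂ) • 1 - Complex.I • p)
    (by fun_prop) (by fun_prop) hx hy
    (fun t _ => sub_mem (sub_mem hM (SMulMemClass.smul_mem _ (one_mem _)))
      (SMulMemClass.smul_mem _ (E.le_idealizer hpE)))
    (fun t _ => by
      have := SMulMemClass.smul_mem (2 * Complex.I) hpE
      convert this using 1
      module)
  simpa using key.symm

end Chain

/-! ### Functions of a self-adjoint operator which are constant off a gap -/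

section Gap

variable {B : Type*} [CStarAlgebra B] {E : NonUnitalStarSubalgebra ℂ B}

/-- The function `u(h)` of a self-adjoint element `h`, for a complex function `u` on the line. -/
def lineCfc (h : B) (u : ℝ → ℂ) : B := cfc (fun z : ℂ => u z.re) h

variable {h : B} (hsa : IsSelfAdjoint h)

include hsa in
theorem lineCfc_add {u v : ℝ → ℂ} (hu : Continuous u) (hv : Continuous v) :
    lineCfc h (fun x => u x + v x) = lineCfc h u + lineCfc h v :=
  have := hsa.isStarNormal
  cfc_add (a := h) (fun z : ℂ => u z.re) (fun z => v z.re)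

include hsa in
theorem lineCfc_sub {u v : ℝ → ℂ} (hu : Continuous u) (hv : Continuous v) :
    lineCfc h (fun x => u x - v x) = lineCfc h u - lineCfc h v :=
  have := hsa.isStarNormal
  cfc_sub (a := h) (fun z : ℂ => u z.re) (fun z => v z.re)

include hsa in
theorem lineCfc_mul {u v : ℝ → ℂ} (hu : Continuous u) (hv : Continuous v) :
    lineCfc h (fun x => u x * v x) = lineCfc h u * lineCfc h v :=
  have := hsa.isStarNormal
  cfc_mul (fun z : ℂ => u z.re) (fun z => v z.re) h

theorem lineCfc_smul {u : ℝ → ℂ} (c : ℂ) (hu : Continuous u) :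
    lineCfc h (fun x => c * u x) = c • lineCfc h u :=
  cfc_const_mul c (fun z : ℂ => u z.re) h

theorem lineCfc_star (u : ℝ → ℂ) : lineCfc h (fun x => star (u x)) = star (lineCfc h u) :=
  cfc_star (fun z : ℂ => u z.re) h

include hsa in
theorem lineCfc_const (c : ℂ) : lineCfc h (fun _ => c) = c • 1 := by
  have := hsa.isStarNormal
  rw [lineCfc, cfc_const c h this, Algebra.algebraMap_eq_smul_one]

include hsa in
theorem lineCfc_id : lineCfc h (fun x => (x : ℂ)) = h := by
  have := hsa.isStarNormal
  rw [lineCfc, cfc_congr (g := fun z : ℂ => z) fun z hz => (hsa.mem_spectrum_eq_re hz).symm,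
    cfc_id' ℂ h this]

include hsa in
theorem isUnit_lineCfc {u : ℝ → ℂ} (hu : Continuous u) (h0 : ∀ x, u x ≠ 0) :
    IsUnit (lineCfc h u) :=
  have := hsa.isStarNormal
  (isUnit_cfc_iff (fun z : ℂ => u z.re) h).2 fun _ _ => h0 _

theorem lineCfc_mem {S : StarSubalgebra ℂ B} (hS : IsClosed (S : Set B)) (hh : h ∈ S)
    (u : ℝ → ℂ) : lineCfc h u ∈ S :=
  cfc_mem (hs := hS) _ hh

include hsa in
theorem lineCfc_ofReal (f : ℝ → ℝ) : lineCfc h (fun x => (f x : ℂ)) = cfc f h :=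
  (cfc_real_eq_complex f hsa).symm

include hsa in
theorem lineCfc_exp {f : ℝ → ℝ} (hf : Continuous f) (c : ℂ) :
    lineCfc h (fun x => Complex.exp (c * f x)) = NormedSpace.exp (c • cfc f h) := by
  have := hsa.isStarNormal
  have hn : IsStarNormal (lineCfc h fun x => c * f x) := cfc_predicate _ _
  rw [← lineCfc_ofReal hsa, ← lineCfc_smul _ (by fun_prop),
    ← CFC.complex_exp_eq_normedSpace_exp (ha := hn)]
  exact cfc_comp' Complex.exp (fun z : ℂ => c * f z.re) h

variable (hE : IsClosed (E : Set B)) (hM : h ∈ E.idealizer)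

/-- The parabola over the gap `(a, b)`. -/
def gapBump (a b x : ℝ) : ℝ := max 0 ((x - a) * (b - x))

theorem continuous_gapBump (a b : ℝ) : Continuous (gapBump a b) := by
  unfold gapBump; fun_prop

theorem gapBump_nonneg (a b x : ℝ) : 0 ≤ gapBump a b x := le_max_left _ _

theorem gapBump_eq_zero {a b x : ℝ} (hab : a < b) (hx : x ∉ Set.Ioo a b) : gapBump a b x = 0 := by
  refine max_eq_left ?_
  by_cases h : a < x
  · have : b ≤ x := not_lt.1 fun h' => hx ⟨h, h'⟩
    exact mul_nonpos_of_nonneg_of_nonpos (by linarith) (by linarith)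
  · exact mul_nonpos_of_nonpos_of_nonneg (by linarith) (by linarith)

theorem gapBump_pos {a b x : ℝ} (hx : x ∈ Set.Ioo a b) : 0 < gapBump a b x :=
  lt_max_of_lt_right (mul_pos (sub_pos.2 hx.1) (sub_pos.2 hx.2))

-- The straight line from `u(h)`, with `u = x - μ + iχ`, to `v(h)`, with `v = -exp(-iπ f) = -cos πf
-- + i sin πf`. Both functions are real off the gap, so each differs from its conjugate by a
-- function supported in the gap, hence by an element of `E` after evaluation at `h`.
include hE hsa hM in
theorem edgeHomotopic_gap {a b μ : ℝ} (haμ : a < μ) (hμb : μ < b)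
    (hgap : ∀ u : ℝ → ℂ, Continuous u → (∀ x ∉ Set.Ioo a b, u x = 0) → lineCfc h u ∈ E)
    {f : ℝ → ℝ} (hf : Continuous f) (hf0 : ∀ x, 0 ≤ f x) (hf1 : ∀ x, f x ≤ 1)
    (hfa : ∀ x ≤ a, f x = 0) (hfb : ∀ x ≥ b, f x = 1) :
    EdgeHomotopic E
      ((h - (μ : ℂ) • 1 + Complex.I • cfc (gapBump a b) h) *
        Ring.inverse (h - (μ : ℂ) • 1 - Complex.I • cfc (gapBump a b) h))
      (NormedSpace.exp (-((2 * Real.pi * Complex.I : ℂ) • cfc f h))) := by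
  have hab := haμ.trans hμb
  have hχ := continuous_gapBump a b
  set u : ℝ → ℂ := fun x => ((x : ℂ) - μ) + Complex.I * gapBump a b x with hu
  set v : ℝ → ℂ := fun x => -Complex.exp (-(Real.pi * Complex.I) * f x) with hv
  have huc : Continuous u := by fun_prop
  have hvc : Continuous v := by fun_prop
  have hvre : ∀ x, v x = ((-Real.cos (Real.pi * f x) : ℝ) : ℂ) +
      (Real.sin (Real.pi * f x) : ℝ) * Complex.I := fun x => by
    have : -(Real.pi * Complex.I) * f x = ((-(Real.pi * f x) : ℝ) : ℂ) * Complex.I := by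
      push_cast; ring
    rw [hv]
    simp only [this, Complex.exp_mul_I]
    rw [← Complex.ofReal_cos, ← Complex.ofReal_sin, Real.cos_neg, Real.sin_neg]
    push_cast; ring
  have hu' : lineCfc h u = h - (μ : ℂ) • 1 + Complex.I • cfc (gapBump a b) h := by
    rw [hu, lineCfc_add hsa (by fun_prop) (by fun_prop), lineCfc_sub hsa (by fun_prop)
      (by fun_prop), lineCfc_smul _ (by fun_prop), lineCfc_id hsa, lineCfc_const hsa,
      lineCfc_ofReal hsa]
  have hus : star (lineCfc h u) = h - (μ : ℂ) • 1 - Complex.I • cfc (gapBump a b) h := by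
    have hc : IsSelfAdjoint (cfc (gapBump a b) h) := cfc_predicate _ _
    rw [hu']
    simp [hsa.star_eq, hc.star_eq, sub_eq_add_neg]
  have hstar : ∀ w : ℝ → ℂ, Continuous w → (∀ x ∉ Set.Ioo a b, star (w x) = w x) →
      lineCfc h w - star (lineCfc h w) ∈ E := fun w hw h0 => by
    rw [← lineCfc_star, ← lineCfc_sub hsa hw (by fun_prop)]
    exact hgap _ (by fun_prop) fun x hx => by rw [h0 x hx, sub_self]
  have hf01 : ∀ x ∉ Set.Ioo a b, (x ≤ a ∧ f x = 0) ∨ (b ≤ x ∧ f x = 1) := fun x hx => by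
    by_cases h : x ≤ a
    · exact Or.inl ⟨h, hfa x h⟩
    · have : b ≤ x := not_lt.1 fun h' => hx ⟨not_le.1 h, h'⟩
      exact Or.inr ⟨this, hfb x this⟩
  have hcl := E.isClosed_idealizer hE
  have key := edgeHomotopic_convex hE (lineCfc_mem hcl hM u) (lineCfc_mem hcl hM v)
    (hstar u huc fun x hx => by simp [hu, gapBump_eq_zero hab hx])
    (hstar v hvc fun x hx => by
      rw [hvre]
      rcases hf01 x hx with ⟨_, h⟩ | ⟨_, h⟩ <;> simp [h])
    (fun t ht => by
      rw [← lineCfc_smul _ huc, ← lineCfc_smul _ hvc,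
        ← lineCfc_add hsa (by fun_prop) (by fun_prop)]
      refine isUnit_lineCfc hsa (by fun_prop) fun x h0 => ?_
      rw [hvre] at h0
      have hre : (1 - t) * (x - μ) + t * (-Real.cos (Real.pi * f x)) = 0 := by
        have := congrArg Complex.re h0
        simpa [hu, -Complex.ofReal_cos, -Complex.ofReal_sin] using this
      have him : (1 - t) * gapBump a b x + t * Real.sin (Real.pi * f x) = 0 := by
        have := congrArg Complex.im h0
        simpa [hu, -Complex.ofReal_cos, -Complex.ofReal_sin] using this
      have hs : 0 ≤ Real.sin (Real.pi * f x) := Real.sin_nonneg_of_nonneg_of_le_pi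
        (mul_nonneg Real.pi_pos.le (hf0 x)) (mul_le_of_le_one_right Real.pi_pos.le (hf1 x))
      obtain ⟨ht0, ht1⟩ := ht
      -- A zero is impossible: at `t = 1` the value has modulus one; for `t < 1` the imaginary part
      -- is positive in the gap, and off the gap the real parts `x - μ` and `∓1` have the same sign.
      rcases eq_or_lt_of_le ht1 with rfl | ht1
      · have := Real.sin_sq_add_cos_sq (Real.pi * f x)
        simp at hre him
        simp [hre, him] at this
      · by_cases hx : x ∈ Set.Ioo a b
        · have := mul_pos (sub_pos.2 ht1) (gapBump_pos hx)
          have := mul_nonneg ht0 hs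
          linarith
        · rcases hf01 x hx with ⟨h1, h2⟩ | ⟨h1, h2⟩
          · simp [h2] at hre
            nlinarith
          · simp [h2] at hre
            nlinarith)
  have hvv : v = fun x => (-1 : ℂ) * Complex.exp (-(Real.pi * Complex.I) * f x) := by
    ext x; simp [hv]
  have hend : lineCfc h v * Ring.inverse (star (lineCfc h v)) =
      NormedSpace.exp (-((2 * Real.pi * Complex.I : ℂ) • cfc f h)) := by
    rw [← neg_smul, ← lineCfc_exp hsa hf, ← lineCfc_star]
    symm
    rw [Ring.eq_mul_inverse_iff_mul_eq, ← lineCfc_mul hsa (by fun_prop) (by fun_prop)]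
    · congr 1
      ext x
      have : star (v x) = -Complex.exp (Real.pi * Complex.I * f x) := by
        simp [hv, ← Complex.exp_conj]
      rw [this, hv]
      simp only [mul_neg, ← Complex.exp_add]
      congr 2
      ring
    · exact isUnit_lineCfc hsa (by fun_prop) fun x => by simp [hv]
  rwa [hend, hus, hu'] at key

end Gap

/-! ### The whole chain of homotopies, in an abstract C*-algebra -/

section Chain
variable {B : Type*} [CStarAlgebra B] {E : NonUnitalStarSubalgebra ℂ B}

theorem isUnit_one_add_smul_ringInverse_mul {x p : B} {c : ℂ} (hx : IsUnit x)
    (h : IsUnit (x + c • p)) : IsUnit (1 + c • (Ring.inverse x * p)) := by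
  have : 1 + c • (Ring.inverse x * p) = Ring.inverse x * (x + c • p) := by
    rw [mul_add, Ring.inverse_mul_cancel _ hx, mul_smul_comm]
  rw [this]
  exact hx.ringInverse.mul h

/-- Invertibility of `p (x⁻¹ + c) p` on the range of `p`. -/
theorem isUnit_compression_add {x p : B} (hp : IsIdempotentElem p) {c d : ℂ} (hcd : c * d = -1)
    (hx : IsUnit x) (h : IsUnit (x - d • p)) :
    IsUnit (1 - p + p * Ring.inverse x * p + c • p) := by
  have hc : c ≠ 0 := by rintro rfl; simp at hcd
  have hgp : p * (p * Ring.inverse x * p) = p * Ring.inverse x * p := by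
    simp only [← mul_assoc, hp.eq]
  rw [← one_sub_add_smul_mul hgp hcd]
  -- What remains is `1 - d p x⁻¹ p`; exchanging factors reduces it to `1 - d x⁻¹ p = x⁻¹ (x - d
  -- p)`.
  refine (isUnit_one_sub_add_smul hp hc).mul ?_
  have h1 := isUnit_one_add_smul_ringInverse_mul (c := -d) hx (by simpa [sub_eq_add_neg] using h)
  have h2 : 1 + -d • (Ring.inverse x * p) = 1 + (-d • (Ring.inverse x * p)) * p := by
    rw [smul_mul_assoc, mul_assoc, hp.eq]
  rw [h2] at h1
  have h3 := isUnit_one_add_mul_comm h1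
  simpa [mul_assoc, sub_eq_add_neg] using h3

variable (hE : IsClosed (E : Set B)) {h p : B} (hsa : IsSelfAdjoint h) (hM : h ∈ E.idealizer)
  (hp : IsIdempotentElem p) (hps : IsSelfAdjoint p) (hpE : p ∈ E)

-- Composes the six homotopies. The invertibility statements `hx`, `hy`, `hq` and the membership
-- `hgap` are all that is needed from the bulk gap; the last end point is the inverse of the
-- exponential, whence the sign.
include hE hsa hM hp hps hpE in
theorem exists_kOne_exp_eq_neg_cayley {a b μ δ : ℝ} (hδ : 0 < δ) (haμ : a < μ) (hμb : μ < b)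
    (hgap : ∀ u : ℝ → ℂ, Continuous u → (∀ x ∉ Set.Ioo a b, u x = 0) → lineCfc h u ∈ E)
    (hx : ∀ t ∈ Set.Icc (0 : ℝ) 1,
      IsUnit (h - (μ + (t * δ : ℝ) * Complex.I : ℂ) • 1 + Complex.I • p))
    (hy : ∀ t ∈ Set.Icc (0 : ℝ) 1,
      IsUnit (h - (μ + (t * δ : ℝ) * Complex.I : ℂ) • 1 - Complex.I • p))
    (hq : ∀ t ∈ Set.Icc (0 : ℝ) 1, IsUnit (h - (μ : ℂ) • 1 +
      Complex.I • (((1 - t : ℝ) : ℂ) • p + (t : ℂ) • cfc (gapBump a b) h)))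
    {f : ℝ → ℝ} (hf : Continuous f) (hf0 : ∀ x, 0 ≤ f x) (hf1 : ∀ x, f x ≤ 1)
    (hfa : ∀ x ≤ a, f x = 0) (hfb : ∀ x ≥ b, f x = 1) :
    ∃ U V : (StarAlgebra.adjoin ℂ (E : Set B))ˣ,
      (U : B) = NormedSpace.exp ((2 * Real.pi * Complex.I : ℂ) • cfc f h) ∧
      (V : B) = (1 - p + p * Ring.inverse (h - (μ + δ * Complex.I : ℂ) • 1) * p - Complex.I • p) *
        Ring.inverse
          (1 - p + p * Ring.inverse (h - (μ + δ * Complex.I : ℂ) • 1) * p + Complex.I • p) ∧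
      KOne.mk U = -KOne.mk V := by
  set z : ℂ := μ + δ * Complex.I with hz
  have hzim : z.im = δ := by simp [hz]
  have hu : IsUnit (h - z • (1 : B)) := hsa.isUnit_sub_smul_one (by rw [hzim]; exact hδ.ne')
  have hcl := E.isClosed_idealizer hE
  have hzM : h - z • (1 : B) ∈ E.idealizer := sub_mem hM (SMulMemClass.smul_mem _ (one_mem _))
  have hpM := E.le_idealizer hpE
  set r := Ring.inverse (h - z • (1 : B)) with hr
  have hrM : r ∈ E.idealizer := StarSubalgebra.ringInverse_mem hcl hzM hu
  have hx1 : IsUnit (h - z • 1 + Complex.I • p) := by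
    simpa [hz] using hx 1 (by simp)
  have hy1 : IsUnit (h - z • 1 - Complex.I • p) := by
    simpa [hz] using hy 1 (by simp)
  have hrx : IsUnit (1 + Complex.I • (r * p)) := isUnit_one_add_smul_ringInverse_mul hu hx1
  have hry : IsUnit (1 - Complex.I • (r * p)) := by
    have := isUnit_one_add_smul_ringInverse_mul (c := -Complex.I) (p := p) hu
      (by simpa only [neg_smul, ← sub_eq_add_neg] using hy1)
    simpa only [neg_smul, ← sub_eq_add_neg] using this
  have hcomp : ∀ c : ℂ, IsUnit (1 + c • (r * p)) → IsUnit (1 + c • (p * r * p)) := fun c hc => by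
    have h2 : 1 + c • (r * p) = 1 + (c • (r * p)) * p := by
      rw [smul_mul_assoc, mul_assoc, hp.eq]
    rw [h2] at hc
    simpa [mul_assoc] using isUnit_one_add_mul_comm hc
  have step1 := edgeHomotopic_cayley_phase hE hp hpE (g := p * r * p)
    ((mul_mem hpM hrM _ hpE).1) (by simp only [← mul_assoc, hp.eq]) (hcomp _ hrx) (by
      have := hcomp (-Complex.I) (by simpa [sub_eq_add_neg] using hry)
      simpa [sub_eq_add_neg] using this)
  have step2 := edgeHomotopic_compress hE hp hpE hrM hrx hry
  have hxy : h - z • 1 + Complex.I • p - (h - z • 1 - Complex.I • p) ∈ E := by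
    have := SMulMemClass.smul_mem (2 * Complex.I) hpE
    convert this using 1
    module
  have step3 := edgeHomotopic_conj hE hsa hM (z := z) (by rw [hzim]; exact hδ) hx1 hy1
    (sub_mem hzM (SMulMemClass.smul_mem _ hpM)) hxy
  -- The common left factor `r` is what `edgeHomotopic_conj` deforms away.
  have ex : r * (h - z • 1 + Complex.I • p) = 1 + Complex.I • (r * p) := by
    rw [mul_add, Ring.inverse_mul_cancel _ hu, mul_smul_comm]
  have ey : r * (h - z • 1 - Complex.I • p) = 1 - Complex.I • (r * p) := by
    rw [mul_sub, Ring.inverse_mul_cancel _ hu, mul_smul_comm]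
  rw [← hr, ex, ey] at step3
  have step4 := edgeHomotopic_energy hE hM hpE μ δ hx hy
  rw [← hz] at step4
  have hχ : lineCfc h (fun x => (gapBump a b x : ℂ)) ∈ E :=
    hgap _ (Complex.continuous_ofReal.comp (continuous_gapBump a b)) fun x hx => by
      rw [gapBump_eq_zero (haμ.trans hμb) hx, Complex.ofReal_zero]
  rw [lineCfc_ofReal hsa] at hχ
  have hstar : ∀ q : B, IsSelfAdjoint q → star (h - (μ : ℂ) • 1 + Complex.I • q) =
      h - (μ : ℂ) • 1 - Complex.I • q := fun q hq => by
    simp [hsa.star_eq, hq.star_eq, sub_eq_add_neg]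
  have hχs : IsSelfAdjoint (cfc (gapBump a b) h) := cfc_predicate _ _
  have hM' : ∀ q ∈ E, h - (μ : ℂ) • 1 + Complex.I • q ∈ E.idealizer := fun q hq =>
    add_mem (sub_mem hM (SMulMemClass.smul_mem _ (one_mem _)))
      (SMulMemClass.smul_mem _ (E.le_idealizer hq))
  have hE' : ∀ q ∈ E, IsSelfAdjoint q → h - (μ : ℂ) • 1 + Complex.I • q -
      star (h - (μ : ℂ) • 1 + Complex.I • q) ∈ E := fun q hq hqs => by
    rw [hstar q hqs]
    have := SMulMemClass.smul_mem (2 * Complex.I) hq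
    convert this using 1
    module
  have step5 := edgeHomotopic_convex hE (hM' p hpE) (hM' _ hχ) (hE' p hpE hps) (hE' _ hχ hχs)
    (fun t ht => by
      convert hq t ht using 1
      push_cast
      module)
  rw [hstar p hps, hstar _ hχs] at step5
  have step6 := edgeHomotopic_gap hsa hE hM haμ hμb hgap hf hf0 hf1 hfa hfb
  refine (((((step1.trans step2).trans step3).trans step4).trans step5).trans
    step6).exists_kOne_eq_neg ?_
  let +nondep : NormedAlgebra ℚ B := .restrictScalars ℚ ℂ B
  rw [← NormedSpace.exp_add_of_commute (Commute.neg_left (Commute.refl _)), neg_add_cancel,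
    NormedSpace.exp_zero]

end Chain

/-! ### Matrix elements of products and adjoints -/

section SiteRestrict

variable {ι κ : Type*} {L : ℕ}

theorem siteRestrict_apply (f : ι ↪ κ) (ψ : L2 κ L) (i : ι) : siteRestrict L f ψ i = ψ (f i) := rfl

open Classical in
theorem L2.inner_single_left (i : ι) (v : EuclideanSpace ℂ (Fin L)) (ψ : L2 ι L) :
    inner ℂ (lp.single 2 i v : L2 ι L) ψ = inner ℂ v (ψ i) := lp.inner_single_left i v ψ

open Classical in
theorem L2.inner_single_right (i : ι) (v : EuclideanSpace ℂ (Fin L)) (ψ : L2 ι L) :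
    inner ℂ ψ (lp.single 2 i v : L2 ι L) = inner ℂ (ψ i) v := lp.inner_single_right i v ψ

open Classical in
theorem siteRestrict_single (f : ι ↪ κ) (i : ι) (v : EuclideanSpace ℂ (Fin L)) :
    siteRestrict L f (lp.single 2 (f i) v) = lp.single 2 i v := by
  ext j : 2
  rw [siteRestrict_apply]
  by_cases h : j = i
  · subst h; simp
  · rw [lp.single_apply_ne _ _ _ h, lp.single_apply_ne _ _ _ (f.injective.ne h)]

open Classical in
theorem siteRestrict_adjoint_apply (f : ι ↪ κ) (φ : L2 ι L) (i : ι) :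
    ContinuousLinearMap.adjoint (siteRestrict L f) φ (f i) = φ i := by
  refine ext_inner_left ℂ fun v : EuclideanSpace ℂ (Fin L) => ?_
  refine (L2.inner_single_left (f i) v _).symm.trans ?_
  rw [ContinuousLinearMap.adjoint_inner_right, siteRestrict_single]
  exact L2.inner_single_left i v φ

open Classical in
theorem siteRestrict_adjoint_apply_of_notMem (f : ι ↪ κ) (φ : L2 ι L) {j : κ}
    (hj : j ∉ Set.range f) : ContinuousLinearMap.adjoint (siteRestrict L f) φ j = 0 := by
  refine ext_inner_left ℂ fun v : EuclideanSpace ℂ (Fin L) => ?_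
  have : siteRestrict L f (lp.single 2 j v) = 0 := by
    ext i : 2
    rw [siteRestrict_apply, lp.single_apply_ne _ _ _ fun h => hj ⟨i, h⟩]
    rfl
  refine (L2.inner_single_left j v _).symm.trans ?_
  rw [ContinuousLinearMap.adjoint_inner_right, this]
  simp

theorem siteRestrict_comp_adjoint (f : ι ↪ κ) :
    siteRestrict L f ∘L ContinuousLinearMap.adjoint (siteRestrict L f) = 1 := by
  ext φ i : 3
  exact siteRestrict_adjoint_apply f φ i

open Classical in
theorem siteRestrict_adjoint_single (f : ι ↪ κ) (i : ι) (v : EuclideanSpace ℂ (Fin L)) :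
    ContinuousLinearMap.adjoint (siteRestrict L f) (lp.single 2 i v) = lp.single 2 (f i) v := by
  ext j : 2
  by_cases hj : j ∈ Set.range f
  · obtain ⟨k, rfl⟩ := hj
    rw [siteRestrict_adjoint_apply]
    by_cases h : k = i
    · subst h; simp
    · rw [lp.single_apply_ne _ _ _ h, lp.single_apply_ne _ _ _ (f.injective.ne h)]
  · rw [siteRestrict_adjoint_apply_of_notMem _ _ hj, lp.single_apply_ne]
    rintro rfl
    exact hj ⟨i, rfl⟩

end SiteRestrict

section Families

/-! Shortcuts for instance search. -/

local instance (Ω ι : Type*) (L : ℕ) : NormedRing (OpFamily Ω ι L) := inferInstance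

local instance (Ω ι : Type*) (L : ℕ) : Ring (OpFamily Ω ι L) := inferInstance

local instance (Ω ι : Type*) (L : ℕ) : AddCommGroup (OpFamily Ω ι L) := inferInstance

local instance (Ω ι : Type*) (L : ℕ) : AddMonoid (OpFamily Ω ι L) := inferInstance

local instance (Ω ι : Type*) (L : ℕ) : StarRing (OpFamily Ω ι L) := inferInstance

local instance (Ω ι : Type*) (L : ℕ) : StarAddMonoid (OpFamily Ω ι L) := inferInstance

local instance (Ω ι : Type*) (L : ℕ) : Module ℂ (OpFamily Ω ι L) := inferInstance

local instance (Ω ι : Type*) (L : ℕ) : Algebra ℂ (OpFamily Ω ι L) := inferInstance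

local instance (Ω ι : Type*) (L : ℕ) : Algebra ℝ (OpFamily Ω ι L) := inferInstance

local instance (Ω ι : Type*) (L : ℕ) : SMul ℂ (OpFamily Ω ι L) := inferInstance

local instance (Ω ι : Type*) (L : ℕ) : Mul (OpFamily Ω ι L) := inferInstance

local instance (Ω ι : Type*) (L : ℕ) : Star (OpFamily Ω ι L) := inferInstance

local instance (Ω ι : Type*) (L : ℕ) : Add (OpFamily Ω ι L) := inferInstance

local instance (Ω ι : Type*) (L : ℕ) : Sub (OpFamily Ω ι L) := inferInstance

local instance (Ω ι : Type*) (L : ℕ) : Neg (OpFamily Ω ι L) := inferInstance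

local instance (Ω ι : Type*) (L : ℕ) : One (OpFamily Ω ι L) := inferInstance

local instance (Ω ι : Type*) (L : ℕ) : Norm (OpFamily Ω ι L) := inferInstance

local instance (Ω ι : Type*) (L : ℕ) : StarModule ℂ (OpFamily Ω ι L) := inferInstance

local instance (Ω ι : Type*) (L : ℕ) : NormedSpace ℂ (OpFamily Ω ι L) := inferInstance

local instance (Ω ι : Type*) (L : ℕ) : TopologicalSpace (OpFamily Ω ι L) := inferInstance

local instance (Ω ι : Type*) (L : ℕ) : SeminormedAddCommGroup (OpFamily Ω ι L) := inferInstance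

local instance (Ω ι : Type*) (L : ℕ) : Monoid (OpFamily Ω ι L) := inferInstance

local instance (Ω ι : Type*) (L : ℕ) : CStarRing (OpFamily Ω ι L) := inferInstance

/-! ### Fibers, and matrix elements of products and adjoints of families -/

section Entry

variable {Ω ι κ : Type*} {L : ℕ}

namespace OpFamily

theorem ext_fiber {A B : OpFamily Ω ι L} (h : ∀ ω ψ, A.fiber ω ψ = B.fiber ω ψ) : A = B :=
  DFunLike.ext _ _ fun ω => ContinuousLinearMap.ext (h ω)

theorem fiber_mul (A B : OpFamily Ω ι L) (ω : Ω) (ψ : L2 ι L) :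
    (A * B).fiber ω ψ = A.fiber ω (B.fiber ω ψ) := rfl

theorem fiber_add (A B : OpFamily Ω ι L) (ω : Ω) (ψ : L2 ι L) :
    (A + B).fiber ω ψ = A.fiber ω ψ + B.fiber ω ψ := rfl

theorem fiber_sub (A B : OpFamily Ω ι L) (ω : Ω) (ψ : L2 ι L) :
    (A - B).fiber ω ψ = A.fiber ω ψ - B.fiber ω ψ := rfl

theorem fiber_smul (c : ℂ) (A : OpFamily Ω ι L) (ω : Ω) (ψ : L2 ι L) :
    (c • A).fiber ω ψ = c • A.fiber ω ψ := rfl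

theorem fiber_one (ω : Ω) (ψ : L2 ι L) : (1 : OpFamily Ω ι L).fiber ω ψ = ψ := rfl

theorem fiber_star (A : OpFamily Ω ι L) (ω : Ω) :
    (star A).fiber ω = ContinuousLinearMap.adjoint (A.fiber ω) := rfl

theorem fiber_sandwich (R S : L2 κ L →L[ℂ] L2 ι L) (A : OpFamily Ω κ L) (ω : Ω) (ψ : L2 ι L) :
    (A.sandwich R S).fiber ω ψ = R (A.fiber ω (ContinuousLinearMap.adjoint S ψ)) := rfl

theorem norm_fiber_le (A : OpFamily Ω ι L) (ω : Ω) : ‖A.fiber ω‖ ≤ ‖A‖ :=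
  A.norm_coe_le_norm ω

theorem norm_fiber_apply_le (A : OpFamily Ω ι L) (ω : Ω) (ψ : L2 ι L) :
    ‖A.fiber ω ψ‖ ≤ ‖A‖ * ‖ψ‖ :=
  (A.fiber ω).le_of_opNorm_le (A.norm_fiber_le ω) ψ

open Classical in
theorem entry_def (A : OpFamily Ω ι L) (ω : Ω) (n m : ι) (v : EuclideanSpace ℂ (Fin L)) :
    A.entry ω n m v = A.fiber ω (lp.single 2 m v) n := rfl

theorem entry_add_right (A : OpFamily Ω ι L) (ω : Ω) (n m : ι) (v w : EuclideanSpace ℂ (Fin L)) :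
    A.entry ω n m (v + w) = A.entry ω n m v + A.entry ω n m w := by
  simp [entry_def]

theorem entry_smul_right (A : OpFamily Ω ι L) (ω : Ω) (n m : ι) (c : ℂ)
    (v : EuclideanSpace ℂ (Fin L)) : A.entry ω n m (c • v) = c • A.entry ω n m v := by
  simp [entry_def]

/-- The matrix element as a linear map. -/
def entryₗ (A : OpFamily Ω ι L) (ω : Ω) (n m : ι) :
    EuclideanSpace ℂ (Fin L) →ₗ[ℂ] EuclideanSpace ℂ (Fin L) where
  toFun := A.entry ω n m
  map_add' := A.entry_add_right ω n m
  map_smul' := A.entry_smul_right ω n m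

/-- Only finitely many fixed vectors occur on the right, so continuity in `ω` extends to a vector
that itself depends on `ω`. -/
theorem entry_eq_sum (A : OpFamily Ω ι L) (ω : Ω) (n m : ι) (v : EuclideanSpace ℂ (Fin L)) :
    A.entry ω n m v = ∑ i, v i • A.entry ω n m (EuclideanSpace.basisFun (Fin L) ℂ i) := by
  conv_lhs => rw [← (EuclideanSpace.basisFun (Fin L) ℂ).sum_repr v]
  change A.entryₗ ω n m _ = _
  rw [map_sum]
  simp [entryₗ]

theorem entry_add (A B : OpFamily Ω ι L) (ω : Ω) (n m : ι) (v : EuclideanSpace ℂ (Fin L)) :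
    (A + B).entry ω n m v = A.entry ω n m v + B.entry ω n m v := rfl

theorem entry_sub (A B : OpFamily Ω ι L) (ω : Ω) (n m : ι) (v : EuclideanSpace ℂ (Fin L)) :
    (A - B).entry ω n m v = A.entry ω n m v - B.entry ω n m v := rfl

theorem entry_smul (c : ℂ) (A : OpFamily Ω ι L) (ω : Ω) (n m : ι) (v : EuclideanSpace ℂ (Fin L)) :
    (c • A).entry ω n m v = c • A.entry ω n m v := rfl

theorem entry_one_self (ω : Ω) (n : ι) (v : EuclideanSpace ℂ (Fin L)) :
    (1 : OpFamily Ω ι L).entry ω n n v = v := by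
  simp [entry_def, fiber_one]

theorem entry_one_of_ne (ω : Ω) {n m : ι} (h : n ≠ m) (v : EuclideanSpace ℂ (Fin L)) :
    (1 : OpFamily Ω ι L).entry ω n m v = 0 := by
  simp [entry_def, fiber_one, h]

theorem norm_entry_le (A : OpFamily Ω ι L) (ω : Ω) (n m : ι) (v : EuclideanSpace ℂ (Fin L)) :
    ‖A.entry ω n m v‖ ≤ ‖A‖ * ‖v‖ := by
  classical
  refine (lp.norm_apply_le_norm two_ne_zero _ n).trans ((A.norm_fiber_apply_le ω _).trans ?_)
  rw [lp.norm_single (by norm_num)]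

theorem hasSum_entry (A : OpFamily Ω ι L) (ω : Ω) (n : ι) (ψ : L2 ι L) :
    HasSum (fun r => A.entry ω n r (ψ r)) (A.fiber ω ψ n) := by
  classical
  have h := (lp.hasSum_single (p := 2) (by norm_num) ψ).mapL (A.fiber ω)
  exact h.mapL (lp.evalCLM ℂ (fun _ : ι => EuclideanSpace ℂ (Fin L)) 2 n)

theorem fiber_apply_eq_zero (A : OpFamily Ω ι L) (ω : Ω) (n : ι) (ψ : L2 ι L)
    (h : ∀ r, A.entry ω n r (ψ r) = 0) : A.fiber ω ψ n = 0 :=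
  (A.hasSum_entry ω n ψ).unique (by simp [h])

theorem hasSum_entry_mul (A B : OpFamily Ω ι L) (ω : Ω) (n m : ι) (v : EuclideanSpace ℂ (Fin L)) :
    HasSum (fun r => A.entry ω n r (B.entry ω r m v)) ((A * B).entry ω n m v) :=
  A.hasSum_entry ω n _

theorem entry_mul_eq_zero {A B : OpFamily Ω ι L} {ω : Ω} {n m : ι} {v : EuclideanSpace ℂ (Fin L)}
    (h : ∀ r, A.entry ω n r (B.entry ω r m v) = 0) : (A * B).entry ω n m v = 0 :=
  A.fiber_apply_eq_zero ω n _ h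

theorem entry_zero_right (A : OpFamily Ω ι L) (ω : Ω) (n m : ι) : A.entry ω n m 0 = 0 :=
  map_zero (A.entryₗ ω n m)

theorem inner_entry_star (A : OpFamily Ω ι L) (ω : Ω) (n m : ι)
    (v w : EuclideanSpace ℂ (Fin L)) :
    inner ℂ w ((star A).entry ω n m v) = inner ℂ (A.entry ω m n w) v := by
  classical
  refine (L2.inner_single_left n w _).symm.trans ?_
  rw [fiber_star, ContinuousLinearMap.adjoint_inner_right]
  refine (L2.inner_single_right m v _).trans ?_
  rw [entry_def]

/-- Writes matrix elements of the adjoint through those of `A`, so that covariance, range and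
continuity pass to adjoints. -/
theorem entry_star_eq_sum (A : OpFamily Ω ι L) (ω : Ω) (n m : ι) (v : EuclideanSpace ℂ (Fin L)) :
    (star A).entry ω n m v = ∑ i, inner ℂ (A.entry ω m n (EuclideanSpace.basisFun (Fin L) ℂ i)) v •
      EuclideanSpace.basisFun (Fin L) ℂ i := by
  simp_rw [← inner_entry_star]
  exact ((EuclideanSpace.basisFun (Fin L) ℂ).sum_repr' _).symm

theorem entry_sandwich (f : ι ↪ κ) (A : OpFamily Ω κ L) (ω : Ω) (n m : ι)
    (v : EuclideanSpace ℂ (Fin L)) :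
    (A.sandwich (siteRestrict L f) (siteRestrict L f)).entry ω n m v = A.entry ω (f n) (f m) v := by
  classical
  simp only [entry_def, fiber_sandwich, siteRestrict_apply]
  rw [siteRestrict_adjoint_single]

theorem continuous_entry (ω : Ω) (n m : ι) (v : EuclideanSpace ℂ (Fin L)) :
    Continuous fun A : OpFamily Ω ι L => A.entry ω n m v := by
  refine (LipschitzWith.of_dist_le_mul (K := ‖v‖₊) fun A B => ?_).continuous
  rw [dist_eq_norm, ← entry_sub, dist_eq_norm, mul_comm]
  exact norm_entry_le _ _ _ _ _

theorem isClosed_continuousEntries [TopologicalSpace Ω] :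
    IsClosed {A : OpFamily Ω ι L | A.ContinuousEntries} := by
  refine isClosed_of_closure_subset fun A hA n m v => ?_
  refine continuous_of_uniform_approx_of_continuous fun u hu => ?_
  obtain ⟨ε, hε, hεu⟩ := Metric.mem_uniformity_dist.1 hu
  have hpos : 0 < ε / (‖v‖ + 1) := by positivity
  obtain ⟨B, hB, hAB⟩ := Metric.mem_closure_iff.1 hA _ hpos
  refine ⟨fun ω => B.entry ω n m v, hB n m v, fun ω => hεu ?_⟩
  rw [dist_eq_norm, ← entry_sub]
  refine (norm_entry_le _ _ _ _ _).trans_lt ?_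
  rw [dist_eq_norm, lt_div_iff₀ (by positivity)] at hAB
  exact lt_of_le_of_lt (by gcongr; linarith) hAB

end OpFamily

end Entry

/-! ### Equivariant local families -/

section Local

variable {Ω ι κ G : Type*} {L : ℕ}

/-- Covariance with respect to maps `T g` of `Ω` and permutations `τ g` of the sites. -/
def OpFamily.Equivariant (T : G → Ω → Ω) (τ : G → Equiv.Perm ι) (A : OpFamily Ω ι L) : Prop :=
  ∀ g ω n m v, A.entry (T g ω) (τ g n) (τ g m) v = A.entry ω n m v

/-- Equivariant families of short range with continuous matrix elements. -/
structure OpFamily.IsLocal [TopologicalSpace Ω] [PseudoMetricSpace ι] (T : G → Ω → Ω)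
    (τ : G → Equiv.Perm ι) (A : OpFamily Ω ι L) : Prop where
  equivariant : A.Equivariant T τ
  continuousEntries : A.ContinuousEntries
  hasRange : ∃ R : ℝ, A.HasRange R

namespace OpFamily

variable {T : G → Ω → Ω} {τ : G → Equiv.Perm ι} {A B : OpFamily Ω ι L}

theorem isClosed_equivariant : IsClosed {A : OpFamily Ω ι L | A.Equivariant T τ} := by
  simp only [Equivariant, Set.ofPred_forall]
  exact isClosed_iInter fun g => isClosed_iInter fun ω => isClosed_iInter fun n =>
    isClosed_iInter fun m => isClosed_iInter fun v =>
      isClosed_eq (continuous_entry _ _ _ _) (continuous_entry _ _ _ _)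

theorem Equivariant.mul (hA : A.Equivariant T τ) (hB : B.Equivariant T τ) :
    (A * B).Equivariant T τ := fun g ω n m v => by
  have h := (τ g).hasSum_iff.2 (A.hasSum_entry_mul B (T g ω) (τ g n) (τ g m) v)
  refine h.unique ?_
  convert A.hasSum_entry_mul B ω n m v using 2 with r
  simp [hB g ω, hA g ω]

theorem Equivariant.star (hA : A.Equivariant T τ) : (star A).Equivariant T τ :=
  fun g ω n m v => by simp only [entry_star_eq_sum, hA g ω]

theorem HasRange.mul [PseudoMetricSpace ι] {R R' : ℝ} (hA : A.HasRange R) (hB : B.HasRange R') :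
    (A * B).HasRange (R + R') := fun ω n m v hd => entry_mul_eq_zero fun r => by
  by_cases h : R < dist n r
  · exact hA _ _ _ _ h
  · have := dist_triangle n r m
    rw [hB _ _ _ _ (by linarith), entry_zero_right]

theorem HasRange.star [PseudoMetricSpace ι] {R : ℝ} (hA : A.HasRange R) :
    (star A).HasRange R := fun ω n m v hd => by
  rw [dist_comm] at hd
  simp [entry_star_eq_sum, hA _ _ _ _ hd]

variable [TopologicalSpace Ω]

theorem ContinuousEntries.star (hA : A.ContinuousEntries) : (star A).ContinuousEntries :=
  fun n m v => by
    simp only [entry_star_eq_sum]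
    have := fun i => hA m n (EuclideanSpace.basisFun (Fin L) ℂ i)
    fun_prop

theorem ContinuousEntries.comp (hA : A.ContinuousEntries) (n m : ι)
    {w : Ω → EuclideanSpace ℂ (Fin L)} (hw : Continuous w) :
    Continuous fun ω => A.entry ω n m (w ω) := by
  have h : ∀ ω, A.entry ω n m (w ω) = _ := fun ω => entry_eq_sum A ω n m (w ω)
  simp only [h]
  have := fun i => hA n m (EuclideanSpace.basisFun (Fin L) ℂ i)
  fun_prop

variable [PseudoMetricSpace ι]

/-- Finite range of the left factor and finiteness of balls turn the series for a matrix element of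
the product into a finite sum. -/
theorem ContinuousEntries.mul [ProperSpace ι] [DiscreteTopology ι] {R : ℝ}
    (hA : A.ContinuousEntries) (hB : B.ContinuousEntries) (hR : A.HasRange R) :
    (A * B).ContinuousEntries := fun n m v => by
  have hfin : (Metric.closedBall n R).Finite := (isCompact_closedBall n R).finite_of_discrete
  have : ∀ ω, (A * B).entry ω n m v =
      ∑ r ∈ hfin.toFinset, A.entry ω n r (B.entry ω r m v) := fun ω =>
    (A.hasSum_entry_mul B ω n m v).unique (hasSum_sum_of_ne_finset_zero fun r hr => by
      refine hR _ _ _ _ ?_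
      simpa [dist_comm] using hr)
  simp only [this]
  exact continuous_finsetSum _ fun r _ => hA.comp n r (hB r m v)

namespace IsLocal

theorem mul [ProperSpace ι] [DiscreteTopology ι] (hA : A.IsLocal T τ) (hB : B.IsLocal T τ) :
    (A * B).IsLocal T τ := by
  obtain ⟨R, hR⟩ := hA.hasRange
  obtain ⟨R', hR'⟩ := hB.hasRange
  exact ⟨hA.1.mul hB.1, hA.2.mul hB.2 hR, _, hR.mul hR'⟩

theorem add (hA : A.IsLocal T τ) (hB : B.IsLocal T τ) : (A + B).IsLocal T τ := by
  obtain ⟨R, hR⟩ := hA.hasRange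
  obtain ⟨R', hR'⟩ := hB.hasRange
  refine ⟨fun g ω n m v => ?_, fun n m v => ?_, max R R', fun ω n m v hd => ?_⟩
  · rw [entry_add, entry_add, hA.1 g, hB.1 g]
  · exact (hA.2 n m v).add (hB.2 n m v)
  · rw [entry_add, hR _ _ _ _ ((le_max_left _ _).trans_lt hd),
      hR' _ _ _ _ ((le_max_right _ _).trans_lt hd), add_zero]

theorem smul (c : ℂ) (hA : A.IsLocal T τ) : (c • A).IsLocal T τ := by
  obtain ⟨R, hR⟩ := hA.hasRange
  refine ⟨fun g ω n m v => ?_, fun n m v => (hA.2 n m v).const_smul c, R, fun ω n m v hd => ?_⟩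
  · rw [entry_smul, entry_smul, hA.1 g]
  · rw [entry_smul, hR _ _ _ _ hd, smul_zero]

theorem sub (hA : A.IsLocal T τ) (hB : B.IsLocal T τ) : (A - B).IsLocal T τ := by
  have := hA.add (hB.smul (-1))
  rwa [neg_one_smul, ← sub_eq_add_neg] at this

theorem star (hA : A.IsLocal T τ) : (star A).IsLocal T τ := by
  obtain ⟨R, hR⟩ := hA.hasRange
  exact ⟨hA.1.star, hA.2.star, R, hR.star⟩

open Classical in
/-- Multiples `χ` of the identity on the sites, `χ` being invariant under all permutations `τ g`. -/
theorem diagonal {χ : ι → Prop} (hχ : ∀ g n, χ (τ g n) ↔ χ n)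
    (h : ∀ ω n m v, A.entry ω n m v = if n = m ∧ χ n then v else 0) : A.IsLocal T τ := by
  refine ⟨fun g ω n m v => ?_, fun n m v => ?_, 0, fun ω n m v hd => ?_⟩
  · simp [h, hχ]
  · simp only [h]
    exact continuous_const
  · rw [h, if_neg]
    rintro ⟨rfl, -⟩
    simp at hd

theorem one : (1 : OpFamily Ω ι L).IsLocal T τ := by
  classical
  refine diagonal (χ := fun _ => True) (by simp) fun ω n m v => ?_
  by_cases hnm : n = m
  · subst hnm; simp [entry_one_self]
  · simp [entry_one_of_ne, hnm]

theorem pow [ProperSpace ι] [DiscreteTopology ι] (hA : A.IsLocal T τ) (k : ℕ) :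
    (A ^ k).IsLocal T τ := by
  induction k with
  | zero => simpa using one
  | succ k ih => rw [pow_succ]; exact ih.mul hA

theorem sandwich [PseudoMetricSpace κ] {σ : G → Equiv.Perm κ} {f : κ ↪ ι} (hf : Isometry f)
    (hσ : ∀ g n, f (σ g n) = τ g (f n)) (hA : A.IsLocal T τ) :
    (A.sandwich (siteRestrict L f) (siteRestrict L f)).IsLocal T σ := by
  obtain ⟨R, hR⟩ := hA.hasRange
  refine ⟨fun g ω n m v => ?_, fun n m v => ?_, R, fun ω n m v hd => ?_⟩
  · rw [entry_sandwich, entry_sandwich, hσ, hσ, hA.1 g]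
  · simp only [entry_sandwich]
    exact hA.2 _ _ v
  · rw [entry_sandwich, hR]
    rwa [hf.dist_eq]

end IsLocal

end OpFamily

end Local

/-! ### Bulk and edge algebras -/

section BulkEdge

variable {Ω : Type*} {d L : ℕ} [TopologicalSpace Ω] [AddAction (BulkSite d) Ω]

namespace OpFamily

/-- Translation of the bulk. -/
def bulkShift (d : ℕ) (a : BulkSite d) : Equiv.Perm (BulkSite d) := Equiv.addRight a

/-- Translation along the boundary, for any set `K` of layers. -/
def bdryShift (d : ℕ) (K : Type*) (a : BdrySite d) : Equiv.Perm (BdrySite d × K) :=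
  (Equiv.addRight a).prodCongr (Equiv.refl K)

theorem bdryShift_apply (K : Type*) (a x : BdrySite d) (k : K) :
    bdryShift d K a (x, k) = (x + a, k) := rfl

/-- Families which are local and covariant along the boundary. -/
abbrev IsBdryLocal {K : Type*} [PseudoMetricSpace K] (A : OpFamily Ω (BdrySite d × K) L) : Prop :=
  A.IsLocal (fun (a : BdrySite d) ω => ((a, 0) : BulkSite d) +ᵥ ω) (bdryShift d K)

omit [TopologicalSpace Ω] in
theorem covariant_iff (A : OpFamily Ω (BulkSite d) L) :
    A.Covariant ↔ A.Equivariant (fun (a : BulkSite d) ω => a +ᵥ ω) (bulkShift d) := by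
  constructor
  · intro h a ω n m v
    simpa [bulkShift] using h a ω (n + a) (m + a) v
  · intro h a ω n m v
    simpa [bulkShift] using h a ω (n - a) (m - a) v

omit [TopologicalSpace Ω] in
theorem bdryCovariant_iff (A : OpFamily Ω (HalfSite d) L) :
    A.BdryCovariant ↔ A.Equivariant (fun (a : BdrySite d) ω => ((a, 0) : BulkSite d) +ᵥ ω)
      (bdryShift d ℕ) := by
  constructor
  · rintro h a ω ⟨x, k⟩ ⟨y, l⟩ v
    simpa [bdryShift_apply] using h a ω (x + a) (y + a) k l v
  · intro h a ω x y k l v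
    simpa [bdryShift_apply] using h a ω (x - a, k) (y - a, l) v

/-- Both conditions survive norm limits, unlike finite range, which `isBdryLocal_of_mem_bulkAlgebra`
therefore takes as a hypothesis. -/
theorem mem_bulkAlgebra {A : OpFamily Ω (BulkSite d) L} (hA : A ∈ bulkAlgebra Ω d L) :
    A.Covariant ∧ A.ContinuousEntries := by
  have key : ∀ B ∈ StarAlgebra.adjoin ℂ {A : OpFamily Ω (BulkSite d) L | A.Covariant ∧
      A.ContinuousEntries ∧ ∃ R : ℝ, A.HasRange R},
      B.IsLocal (fun (a : BulkSite d) ω => a +ᵥ ω) (bulkShift d) := fun B hB => by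
    refine StarAlgebra.adjoin_induction (fun C hC => ?_) (fun r => ?_)
      (fun _ _ _ _ h1 h2 => h1.add h2) (fun _ _ _ _ h1 h2 => h1.mul h2) (fun _ _ h => h.star) hB
    · exact ⟨(covariant_iff C).1 hC.1, hC.2.1, hC.2.2⟩
    · rw [Algebra.algebraMap_eq_smul_one]
      exact IsLocal.one.smul r
  rw [covariant_iff]
  constructor
  · exact isClosed_equivariant.closure_subset_iff.2 (fun B hB => (key B hB).1) hA
  · exact isClosed_continuousEntries.closure_subset_iff.2 (fun B hB => (key B hB).2) hA

theorem isBdryLocal_of_mem_bulkAlgebra {A : OpFamily Ω (BulkSite d) L} {R : ℝ}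
    (hA : A ∈ bulkAlgebra Ω d L) (hR : A.HasRange R) : A.IsBdryLocal := by
  obtain ⟨h1, h2⟩ := mem_bulkAlgebra hA
  refine ⟨?_, h2, R, hR⟩
  rintro a ω ⟨x, k⟩ ⟨y, l⟩ v
  have := h1 (a, 0) ω (x + a, k) (y + a, l) v
  simpa [bdryShift_apply] using this

theorem isometry_halfIncl : Isometry (halfIncl d) := by
  refine Isometry.of_dist_eq fun p q => ?_
  change max (dist p.1 q.1) (dist ((p.2 : ℤ) + 1) ((q.2 : ℤ) + 1)) = max _ _
  simp [Int.dist_eq, Nat.dist_eq]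

theorem IsBdryLocal.half {A : OpFamily Ω (BulkSite d) L} (hA : A.IsBdryLocal) :
    A.half.IsBdryLocal :=
  IsLocal.sandwich isometry_halfIncl (fun _ _ => rfl) hA

theorem IsBdryLocal.mem_edgeAlgebra {A : OpFamily Ω (HalfSite d) L} (hA : A.IsBdryLocal)
    (hs : A.StripSupported) : A ∈ edgeAlgebra Ω d L :=
  subset_closure (NonUnitalStarAlgebra.subset_adjoin ℂ _
    ⟨(bdryCovariant_iff A).2 hA.1, hA.2, hA.3, hs⟩)

theorem IsBdryLocal.mem_edgeAlgebra_of_rows {A : OpFamily Ω (HalfSite d) L} (hA : A.IsBdryLocal)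
    (M : ℕ) (h : ∀ ω x k m v, M ≤ k → A.entry ω (x, k) m v = 0) : A ∈ edgeAlgebra Ω d L := by
  obtain ⟨R, hR⟩ := hA.hasRange
  obtain ⟨r, hr⟩ := exists_nat_gt R
  -- Range below `r` bounds the columns too: a row `k < M` and a column `l ≥ M + r` are more than
  -- `R` apart.
  refine hA.mem_edgeAlgebra ⟨M + r, fun ω x y k l v hkl => ?_⟩
  by_cases hk : M ≤ k
  · exact h _ _ _ _ _ hk
  · refine hR _ _ _ _ (hr.trans_le ?_)
    refine le_trans ?_ (le_max_right _ _)
    have h1 : (r : ℝ) ≤ (l : ℝ) - k := by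
      have : k + r ≤ l := by omega
      have : ((k + r : ℕ) : ℝ) ≤ l := by exact_mod_cast this
      push_cast at this
      linarith
    rw [Nat.dist_eq, abs_sub_comm]
    exact h1.trans (le_abs_self _)

theorem IsBdryLocal.mem_edgeAlgebra_of_columns {A : OpFamily Ω (HalfSite d) L}
    (hA : A.IsBdryLocal) (M : ℕ) (h : ∀ ω n y l v, M ≤ l → A.entry ω n (y, l) v = 0) :
    A ∈ edgeAlgebra Ω d L := by
  have := IsBdryLocal.mem_edgeAlgebra_of_rows (A := star A) hA.star M fun ω x k m v hk => by
    simp [entry_star_eq_sum, h _ _ _ _ _ hk]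
  simpa using star_mem this

theorem isClosed_edgeAlgebra : IsClosed (edgeAlgebra Ω d L : Set (OpFamily Ω (HalfSite d) L)) :=
  isClosed_closure

/-- A local operator times a generator of the edge algebra is local with finitely many nonzero
layers of columns (or rows, in the other order). Density does the rest. -/
theorem IsBdryLocal.mem_idealizer {A : OpFamily Ω (HalfSite d) L} (hA : A.IsBdryLocal) :
    A ∈ (edgeAlgebra Ω d L).idealizer := by
  intro e he
  -- The multiplier is quantified inside the induction, because the adjoint case needs the claim for
  -- its adjoint.
  have key : ∀ e ∈ NonUnitalStarAlgebra.adjoin ℂ {A : OpFamily Ω (HalfSite d) L |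
      A.BdryCovariant ∧ A.ContinuousEntries ∧ (∃ R : ℝ, A.HasRange R) ∧ A.StripSupported},
      ∀ A : OpFamily Ω (HalfSite d) L, A.IsBdryLocal →
        A * e ∈ edgeAlgebra Ω d L ∧ e * A ∈ edgeAlgebra Ω d L := fun e he => by
    refine NonUnitalStarAlgebra.adjoin_induction ℂ (fun C hC A hA => ?_) (fun _ _ _ _ h1 h2 A hA => ?_)
      (fun A hA => ?_) (fun B C hB hC h1 h2 A hA => ?_) (fun c _ _ h A hA => ?_)
      (fun _ _ h A hA => ?_) he
    · obtain ⟨M, hM⟩ := hC.2.2.2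
      have hC' : C.IsBdryLocal := ⟨(bdryCovariant_iff C).1 hC.1, hC.2.1, hC.2.2.1⟩
      constructor
      · refine IsBdryLocal.mem_edgeAlgebra_of_columns (hA.mul hC') M fun ω n y l v hl => ?_
        exact entry_mul_eq_zero fun r => by rw [hM _ _ _ _ _ _ (Or.inr hl), entry_zero_right]
      · refine IsBdryLocal.mem_edgeAlgebra_of_rows (hC'.mul hA) M fun ω x k m v hk => ?_
        exact entry_mul_eq_zero fun r => hM _ _ _ _ _ _ (Or.inl hk)
    · rw [mul_add, add_mul]
      exact ⟨add_mem (h1 A hA).1 (h2 A hA).1, add_mem (h1 A hA).2 (h2 A hA).2⟩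
    · simp
    · constructor
      · rw [← mul_assoc]
        exact mul_mem (h1 A hA).1 (subset_closure hC)
      · rw [mul_assoc]
        exact mul_mem (subset_closure hB) (h2 A hA).2
    · rw [mul_smul_comm, smul_mul_assoc]
      exact ⟨SMulMemClass.smul_mem c (h A hA).1, SMulMemClass.smul_mem c (h A hA).2⟩
    · have := h (star A) hA.star
      exact ⟨by simpa using star_mem this.2, by simpa using star_mem this.1⟩
  constructor
  · exact (isClosed_edgeAlgebra.preimage (continuous_const_mul A)).closure_subset_iff.2
      (fun e he => (key e he A hA).1) he
  · exact (isClosed_edgeAlgebra.preimage (continuous_mul_const A)).closure_subset_iff.2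
      (fun e he => (key e he A hA).2) he

end OpFamily

end BulkEdge

/-! ### Invertible families of operators -/

section Units

variable {Ω ι : Type*} {L : ℕ}

namespace OpFamily

theorem exists_norm_le_of_isUnit {A : OpFamily Ω ι L} (hA : IsUnit A) :
    ∃ C > 0, ∀ ω ψ, ‖ψ‖ ≤ C * ‖A.fiber ω ψ‖ := by
  obtain ⟨u, rfl⟩ := hA
  refine ⟨‖(u⁻¹ : (OpFamily Ω ι L)ˣ).1‖ + 1, by positivity, fun ω ψ => ?_⟩
  have h : (u⁻¹ : (OpFamily Ω ι L)ˣ).1.fiber ω (u.1.fiber ω ψ) = ψ := by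
    rw [← fiber_mul, u.inv_mul, fiber_one]
  calc ‖ψ‖ = ‖(u⁻¹ : (OpFamily Ω ι L)ˣ).1.fiber ω (u.1.fiber ω ψ)‖ := by rw [h]
    _ ≤ ‖(u⁻¹ : (OpFamily Ω ι L)ˣ).1‖ * ‖u.1.fiber ω ψ‖ := norm_fiber_apply_le _ _ _
    _ ≤ _ := by gcongr; linarith

/-- The form of `A* A` is coercive with constant `C⁻²`. -/
theorem isUnit_adjoint_comp_self {H : Type*} [NormedAddCommGroup H] [InnerProductSpace ℂ H]
    [CompleteSpace H] {A : H →L[ℂ] H} {C : ℝ} (hC : 0 < C) (hA : ∀ ψ, ‖ψ‖ ≤ C * ‖A ψ‖) :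
    IsUnit (ContinuousLinearMap.adjoint A * A) := by
  refine ContinuousLinearMap.isUnit_of_forall_le_norm_inner_map _ (c := ⟨(C ^ 2)⁻¹, by positivity⟩)
    (show 0 < (C ^ 2)⁻¹ by positivity) fun ψ => ?_
  rw [mul_apply_eq_comp, ContinuousLinearMap.adjoint_inner_left,
    inner_self_eq_norm_sq_to_K, norm_pow]
  simp only [Complex.coe_algebraMap, Complex.norm_real, norm_norm]
  change ‖ψ‖ ^ 2 * (C ^ 2)⁻¹ ≤ ‖A ψ‖ ^ 2
  rw [mul_inv_le_iff₀ (by positivity), mul_comm, ← mul_pow]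
  exact pow_le_pow_left₀ (norm_nonneg _) (hA ψ) 2

/-- A family which is bounded below, together with its adjoint, uniformly in `ω`, is invertible. -/
theorem isUnit_of_norm_le {A : OpFamily Ω ι L} {C : ℝ} (hC : 0 < C)
    (hA : ∀ ω ψ, ‖ψ‖ ≤ C * ‖A.fiber ω ψ‖) (hA' : ∀ ω ψ, ‖ψ‖ ≤ C * ‖(star A).fiber ω ψ‖) :
    IsUnit A := by
  -- `A* A` yields a left inverse and `A A*` a right one; the lower bound then bounds the inverses
  -- by `C` uniformly in `ω`, so that they form a family in the algebra.
  have hu : ∀ ω, ∃ B : L2 ι L →L[ℂ] L2 ι L, B * A.fiber ω = 1 ∧ A.fiber ω * B = 1 := fun ω => by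
    obtain ⟨u, hu⟩ := isUnit_adjoint_comp_self hC (hA ω)
    obtain ⟨w, hw⟩ := isUnit_adjoint_comp_self hC (hA' ω)
    rw [fiber_star, ContinuousLinearMap.adjoint_adjoint] at hw
    have h1 : (u⁻¹.1 * ContinuousLinearMap.adjoint (A.fiber ω)) * A.fiber ω = 1 := by
      rw [mul_assoc, ← hu, u.inv_mul]
    have h2 : A.fiber ω * (ContinuousLinearMap.adjoint (A.fiber ω) * w⁻¹.1) = 1 := by
      rw [← mul_assoc, ← hw, w.mul_inv]
    exact ⟨_, h1, by rw [left_inv_eq_right_inv h1 h2, h2]⟩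
  choose B hB hB' using hu
  have hn : ∀ ω, ‖B ω‖ ≤ C := fun ω => ContinuousLinearMap.opNorm_le_bound _ hC.le fun ψ => by
    refine (hA ω (B ω ψ)).trans_eq ?_
    rw [← mul_apply_eq_comp, hB', one_apply_eq_self]
  let B' : OpFamily Ω ι L := BoundedContinuousFunction.ofNormedAddCommGroupDiscrete B C hn
  exact ⟨⟨A, B', DFunLike.ext _ _ fun ω => hB' ω, DFunLike.ext _ _ fun ω => hB ω⟩, rfl⟩

theorem inner_fiber_of_isSelfAdjoint {A : OpFamily Ω ι L} (hA : IsSelfAdjoint A) (ω : Ω)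
    (φ ψ : L2 ι L) : inner ℂ (A.fiber ω φ) ψ = inner ℂ φ (A.fiber ω ψ) := by
  have h : ContinuousLinearMap.adjoint (A.fiber ω) = A.fiber ω := by
    rw [← fiber_star, hA.star_eq]
  conv_lhs => rw [← h]
  exact ContinuousLinearMap.adjoint_inner_left _ _ _

theorem im_inner_fiber_self {A : OpFamily Ω ι L} (hA : IsSelfAdjoint A) (ω : Ω) (ψ : L2 ι L) :
    (inner ℂ ψ (A.fiber ω ψ)).im = 0 := by
  rw [← Complex.conj_eq_iff_im, inner_conj_symm, inner_fiber_of_isSelfAdjoint hA]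

/-- The Cauchy-Schwarz inequality for the form of a positive family. -/
theorem norm_sq_fiber_le {Q : OpFamily Ω ι L} (hQ : IsSelfAdjoint Q) {ω : Ω}
    (h0 : ∀ ψ, 0 ≤ (inner ℂ ψ (Q.fiber ω ψ)).re) (ψ : L2 ι L) :
    ‖Q.fiber ω ψ‖ ^ 2 ≤ (‖Q‖ + 1) * (inner ℂ ψ (Q.fiber ω ψ)).re := by
  set K := ‖Q‖ + 1 with hK
  have hKpos : 0 < K := by positivity
  set φ := Q.fiber ω ψ with hφ
  have hsq : (inner ℂ φ φ).re = ‖φ‖ ^ 2 := by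
    rw [inner_self_eq_norm_sq_to_K]; norm_cast
  have h2 : (inner ℂ φ (Q.fiber ω φ)).re ≤ ‖Q‖ * ‖φ‖ ^ 2 := by
    refine (Complex.re_le_norm _).trans ((norm_inner_le_norm _ _).trans ?_)
    calc ‖φ‖ * ‖Q.fiber ω φ‖ ≤ ‖φ‖ * (‖Q‖ * ‖φ‖) := by gcongr; exact norm_fiber_apply_le _ _ _
      _ = _ := by ring
  have h3 : (inner ℂ ψ (Q.fiber ω φ)).re = ‖φ‖ ^ 2 := by
    rw [← inner_fiber_of_isSelfAdjoint hQ, ← hφ, hsq]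
  -- Expanded, this reads `K² ⟨ψ, Qψ⟩ - 2K ‖φ‖² + ⟨φ, Qφ⟩ ≥ 0`, where the last term is at most `K
  -- ‖φ‖²`.
  have h1 := h0 ((K : ℂ) • ψ - φ)
  rw [map_sub, map_smul, ← hφ, inner_sub_left, inner_sub_right, inner_sub_right, inner_smul_left,
    inner_smul_left, inner_smul_right, inner_smul_right, Complex.conj_ofReal] at h1
  simp only [Complex.sub_re, Complex.re_ofReal_mul, hsq, h3] at h1
  have hn := sq_nonneg ‖φ‖
  by_contra! hlt
  have := mul_lt_mul_of_pos_left hlt hKpos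
  nlinarith

/-- With `η = (x + sQ)ψ`, the imaginary part of `⟨ψ, η⟩` gives `⟨ψ, Qψ⟩ ≤ ‖ψ‖ ‖η‖`. This controls
`Qψ` by `norm_sq_fiber_le`, hence `xψ = η - sQψ`, and the form bound then controls `ψ`. Both signs
of `s` are needed to treat the adjoint. -/
theorem norm_le_of_form_bound {x Q : OpFamily Ω ι L} (hx : IsSelfAdjoint x) (hQ : IsSelfAdjoint Q)
    {c : ℝ} (hc : 0 < c) (h0 : ∀ ω ψ, 0 ≤ (inner ℂ ψ (Q.fiber ω ψ)).re)
    (h : ∀ ω ψ, c * ‖ψ‖ ^ 2 ≤ ‖x.fiber ω ψ‖ ^ 2 + (inner ℂ ψ (Q.fiber ω ψ)).re)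
    {s : ℂ} (hs : s = Complex.I ∨ s = -Complex.I) (ω : Ω) (ψ : L2 ι L) :
    ‖ψ‖ ≤ (1 + (2 * ‖Q‖ + 5) / c) * ‖(x + s • Q).fiber ω ψ‖ := by
  set η := (x + s • Q).fiber ω ψ with hη
  set q := (inner ℂ ψ (Q.fiber ω ψ)).re with hq
  have hηe : η = x.fiber ω ψ + s • Q.fiber ω ψ := rfl
  have hs1 : ‖s‖ = 1 := by rcases hs with rfl | rfl <;> simp
  have hqη : q ≤ ‖ψ‖ * ‖η‖ := by
    have e : inner ℂ ψ η = inner ℂ ψ (x.fiber ω ψ) + s * inner ℂ ψ (Q.fiber ω ψ) := by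
      rw [hηe, inner_add_right, inner_smul_right]
    have h1 := norm_inner_le_norm (𝕜 := ℂ) ψ η
    refine le_trans ?_ ((Complex.abs_im_le_norm _).trans h1)
    rw [e, Complex.add_im, im_inner_fiber_self hx, zero_add]
    rcases hs with rfl | rfl
    · simpa using le_abs_self q
    · simpa using le_abs_self q
  have hQψ := norm_sq_fiber_le hQ (h0 ω) ψ
  rw [← hq] at hQψ
  have hxψ : ‖x.fiber ω ψ‖ ≤ ‖η‖ + ‖Q.fiber ω ψ‖ := by
    have : x.fiber ω ψ = η - s • Q.fiber ω ψ := by rw [hηe]; abel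
    rw [this]
    refine (norm_sub_le _ _).trans_eq ?_
    rw [norm_smul, hs1, one_mul]
  have hK : 0 ≤ ‖Q‖ := norm_nonneg _
  have ha := norm_nonneg ψ
  have hb := norm_nonneg η
  have hmain : c * ‖ψ‖ ^ 2 ≤ 2 * ‖η‖ ^ 2 + (2 * ‖Q‖ + 3) * (‖ψ‖ * ‖η‖) := by
    have h1 : ‖x.fiber ω ψ‖ ^ 2 ≤ 2 * ‖η‖ ^ 2 + 2 * ‖Q.fiber ω ψ‖ ^ 2 := by
      have := pow_le_pow_left₀ (norm_nonneg _) hxψ 2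
      nlinarith [sq_nonneg (‖η‖ - ‖Q.fiber ω ψ‖)]
    have h2 : (‖Q‖ + 1) * q ≤ (‖Q‖ + 1) * (‖ψ‖ * ‖η‖) := by gcongr
    have := h ω ψ
    rw [← hq] at this
    nlinarith
  -- The summand `1` of the constant settles the first case; in the second `2‖η‖² ≤ 2‖ψ‖‖η‖`, which
  -- raises `2‖Q‖ + 3` to `2‖Q‖ + 5` and allows division by `‖ψ‖`.
  rcases le_or_gt ‖ψ‖ ‖η‖ with hle | hlt
  · have : 0 ≤ (2 * ‖Q‖ + 5) / c * ‖η‖ := by positivity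
    linarith
  · have h1 : 2 * ‖η‖ ^ 2 ≤ 2 * (‖ψ‖ * ‖η‖) := by nlinarith
    have h2 : ‖ψ‖ * (c * ‖ψ‖) ≤ ‖ψ‖ * ((2 * ‖Q‖ + 5) * ‖η‖) := by nlinarith
    have h3 := le_of_mul_le_mul_left h2 (lt_of_le_of_lt hb hlt)
    have h4 : ‖ψ‖ ≤ (2 * ‖Q‖ + 5) / c * ‖η‖ := by
      rw [div_mul_eq_mul_div, le_div_iff₀ hc]
      linarith
    linarith

/-- Invertibility of `x + i Q` for `x` self-adjoint and `Q ≥ 0` with `x² + Q ≥ c > 0`. -/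
theorem isUnit_add_I_smul {x Q : OpFamily Ω ι L} (hx : IsSelfAdjoint x) (hQ : IsSelfAdjoint Q)
    {c : ℝ} (hc : 0 < c) (h0 : ∀ ω ψ, 0 ≤ (inner ℂ ψ (Q.fiber ω ψ)).re)
    (h : ∀ ω ψ, c * ‖ψ‖ ^ 2 ≤ ‖x.fiber ω ψ‖ ^ 2 + (inner ℂ ψ (Q.fiber ω ψ)).re) :
    IsUnit (x + Complex.I • Q) := by
  refine isUnit_of_norm_le (C := 1 + (2 * ‖Q‖ + 5) / c) (by positivity)
    (norm_le_of_form_bound hx hQ hc h0 h (Or.inl rfl)) ?_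
  have : star (x + Complex.I • Q) = x + (-Complex.I) • Q := by
    simp [hx.star_eq, hQ.star_eq]
  rw [this]
  exact norm_le_of_form_bound hx hQ hc h0 h (Or.inr rfl)

end OpFamily

end Units

/-! ### The half-space restriction -/

section Half

theorem norm_siteRestrict_le {ι κ : Type*} (L : ℕ) (f : ι ↪ κ) : ‖siteRestrict L f‖ ≤ 1 :=
  LinearMap.mkContinuous_norm_le _ zero_le_one _

theorem norm_siteRestrict_apply_le {ι κ : Type*} {L : ℕ} (f : ι ↪ κ) (ψ : L2 κ L) :
    ‖siteRestrict L f ψ‖ ≤ ‖ψ‖ := by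
  simpa using (siteRestrict L f).le_of_opNorm_le (norm_siteRestrict_le L f) ψ

theorem norm_siteRestrict_adjoint_apply {ι κ : Type*} {L : ℕ} (f : ι ↪ κ) (ψ : L2 ι L) :
    ‖ContinuousLinearMap.adjoint (siteRestrict L f) ψ‖ = ‖ψ‖ := by
  refine le_antisymm ?_ ?_
  · have : ‖ContinuousLinearMap.adjoint (siteRestrict L f)‖ ≤ 1 := by
      rw [LinearIsometryEquiv.norm_map]
      exact norm_siteRestrict_le L f
    simpa using ContinuousLinearMap.le_of_opNorm_le _ this ψ
  · have h := norm_siteRestrict_apply_le f (ContinuousLinearMap.adjoint (siteRestrict L f) ψ)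
    rwa [show siteRestrict L f (ContinuousLinearMap.adjoint (siteRestrict L f) ψ) = ψ from
      DFunLike.congr_fun (siteRestrict_comp_adjoint f) ψ] at h

namespace OpFamily

variable {Ω ι κ : Type*} {d L : ℕ}

theorem sandwich_add (R S : L2 κ L →L[ℂ] L2 ι L) (A B : OpFamily Ω κ L) :
    (A + B).sandwich R S = A.sandwich R S + B.sandwich R S :=
  ext_fiber fun ω ψ => by simp only [fiber_sandwich, fiber_add, map_add]

theorem sandwich_sub (R S : L2 κ L →L[ℂ] L2 ι L) (A B : OpFamily Ω κ L) :
    (A - B).sandwich R S = A.sandwich R S - B.sandwich R S :=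
  ext_fiber fun ω ψ => by simp only [fiber_sandwich, fiber_sub, map_sub]

theorem sandwich_smul (R S : L2 κ L →L[ℂ] L2 ι L) (c : ℂ) (A : OpFamily Ω κ L) :
    (c • A).sandwich R S = c • A.sandwich R S :=
  ext_fiber fun ω ψ => by simp only [fiber_sandwich, fiber_smul, map_smul]

theorem star_sandwich (R : L2 κ L →L[ℂ] L2 ι L) (A : OpFamily Ω κ L) :
    star (A.sandwich R R) = (star A).sandwich R R := by
  refine ext_fiber fun ω ψ => ext_inner_right ℂ fun φ => ?_
  rw [fiber_star, fiber_sandwich, fiber_star]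
  refine (ContinuousLinearMap.adjoint_inner_left _ _ _).trans ?_
  rw [fiber_sandwich, ← ContinuousLinearMap.adjoint_inner_right R,
    ContinuousLinearMap.adjoint_inner_left, ContinuousLinearMap.adjoint_inner_left]

theorem isSelfAdjoint_sandwich (R : L2 κ L →L[ℂ] L2 ι L) {A : OpFamily Ω κ L}
    (hA : IsSelfAdjoint A) : IsSelfAdjoint (A.sandwich R R) := by
  rw [isSelfAdjoint_iff, star_sandwich, hA.star_eq]

theorem norm_half_le (A : OpFamily Ω (BulkSite d) L) : ‖A.half‖ ≤ ‖A‖ := by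
  refine (BoundedContinuousFunction.norm_le (norm_nonneg A)).2 fun ω => ?_
  refine ContinuousLinearMap.opNorm_le_bound _ (norm_nonneg A) fun ψ => ?_
  refine (norm_siteRestrict_apply_le _ _).trans ((norm_fiber_apply_le A ω _).trans_eq ?_)
  exact congrArg _ (norm_siteRestrict_adjoint_apply _ ψ)

theorem half_add (A B : OpFamily Ω (BulkSite d) L) : (A + B).half = A.half + B.half :=
  sandwich_add _ _ A B

theorem half_sub (A B : OpFamily Ω (BulkSite d) L) : (A - B).half = A.half - B.half :=
  sandwich_sub _ _ A B

theorem half_smul (c : ℂ) (A : OpFamily Ω (BulkSite d) L) : (c • A).half = c • A.half :=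
  sandwich_smul _ _ c A

theorem half_zero : (0 : OpFamily Ω (BulkSite d) L).half = 0 := by
  simpa using half_sub (0 : OpFamily Ω (BulkSite d) L) 0

theorem half_one : (1 : OpFamily Ω (BulkSite d) L).half = 1 :=
  ext_fiber fun _ ψ => DFunLike.congr_fun (siteRestrict_comp_adjoint (halfIncl d)) ψ

theorem mem_range_halfIncl {r : BulkSite d} (hr : r ∉ Set.range (halfIncl d)) : r.2 ≤ 0 := by
  by_contra! h
  refine hr ⟨(r.1, (r.2 - 1).toNat), Prod.ext rfl ?_⟩
  change ((r.2 - 1).toNat : ℤ) + 1 = r.2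
  omega

/-- Off the first layer, compression to the half-space is multiplicative for a nearest neighbor
left factor. -/
theorem fiber_half_mul {H : OpFamily Ω (BulkSite d) L} (hH : H.HasRange 1)
    (A : OpFamily Ω (BulkSite d) L) (ω : Ω) (ψ : L2 (HalfSite d) L) (x : BdrySite d) {k : ℕ}
    (hk : 1 ≤ k) : (H.half * A.half).fiber ω ψ (x, k) = (H * A).half.fiber ω ψ (x, k) := by
  set φ := A.fiber ω (ContinuousLinearMap.adjoint (siteRestrict L (halfIncl d)) ψ) with hφ
  set φ' := ContinuousLinearMap.adjoint (siteRestrict L (halfIncl d))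
    (siteRestrict L (halfIncl d) φ) with hφ'
  -- The cut-off part `φ' - φ` lives in layers `≤ 0`, while index `k ≥ 1` is layer `k + 1 ≥ 2`, out
  -- of reach of a nearest neighbor operator.
  have h0 : H.fiber ω (φ' - φ) (halfIncl d (x, k)) = 0 := by
    refine fiber_apply_eq_zero _ _ _ _ fun r => ?_
    by_cases hr : r ∈ Set.range (halfIncl d)
    · obtain ⟨s, rfl⟩ := hr
      have : (φ' - φ) (halfIncl d s) = 0 := by
        rw [lp.coeFn_sub, Pi.sub_apply, hφ', siteRestrict_adjoint_apply, siteRestrict_apply,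
          sub_self]
      rw [this, entry_zero_right]
    · refine hH _ _ _ _ (lt_of_lt_of_le ?_ (le_max_right _ _))
      have h1 := mem_range_halfIncl hr
      change (1 : ℝ) < dist ((k : ℤ) + 1) r.2
      rw [Int.dist_eq]
      refine lt_of_lt_of_le ?_ (le_abs_self _)
      have : (2 : ℤ) ≤ (k : ℤ) + 1 - r.2 := by omega
      have : ((2 : ℤ) : ℝ) ≤ (((k : ℤ) + 1 - r.2 : ℤ) : ℝ) := by exact_mod_cast this
      push_cast at this ⊢
      linarith
  have h1 : (H.half * A.half).fiber ω ψ (x, k) = H.fiber ω φ' (halfIncl d (x, k)) := rfl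
  have h2 : (H * A).half.fiber ω ψ (x, k) = H.fiber ω φ (halfIncl d (x, k)) := rfl
  rw [h1, h2, ← sub_eq_zero, ← Pi.sub_apply, ← lp.coeFn_sub, ← map_sub]
  exact h0

variable [TopologicalSpace Ω] [AddAction (BulkSite d) Ω]

/-- Inductively the defect is `Ĥ` times the previous defect, which stays in the ideal, plus a local
operator whose rows live in the first layer only. -/
theorem half_pow_sub_mem {H : OpFamily Ω (BulkSite d) L} (hH : H.HasRange 1) (hl : H.IsBdryLocal)
    (n : ℕ) : H.half ^ n - (H ^ n).half ∈ edgeAlgebra Ω d L := by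
  induction n with
  | zero => simp [half_one]
  | succ n ih =>
    have h1 := (hl.half.mem_idealizer _ ih).1
    have h2 : H.half * (H ^ n).half - (H ^ (n + 1)).half ∈ edgeAlgebra Ω d L := by
      refine IsBdryLocal.mem_edgeAlgebra_of_rows
        ((hl.half.mul (IsBdryLocal.half (hl.pow n))).sub (IsBdryLocal.half (hl.pow (n + 1)))) 1
        fun ω x k m v hk => ?_
      rw [entry_sub, entry_def, entry_def, fiber_half_mul hH _ _ _ _ hk, pow_succ', sub_self]
    have := add_mem h1 h2
    rw [mul_sub, ← pow_succ', sub_add_sub_cancel] at this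
    exact this

theorem half_aeval_sub_mem {H : OpFamily Ω (BulkSite d) L} (hH : H.HasRange 1)
    (hl : H.IsBdryLocal) (p : Polynomial ℝ) :
    Polynomial.aeval H.half p - (Polynomial.aeval H p).half ∈ edgeAlgebra Ω d L := by
  induction p using Polynomial.induction_on' with
  | add p q hp hq =>
    rw [map_add, map_add, half_add, add_sub_add_comm]
    exact add_mem hp hq
  | monomial n c =>
    have h : ∀ {ι : Type} (A : OpFamily Ω ι L),
        Polynomial.aeval A (Polynomial.monomial n c) = (c : ℂ) • A ^ n := fun A => by
      rw [Polynomial.aeval_monomial, Algebra.algebraMap_eq_smul_one, smul_mul_assoc, one_mul,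
        Complex.coe_smul]
    rw [h, h, half_smul, ← smul_sub]
    exact SMulMemClass.smul_mem _ (half_pow_sub_mem hH hl n)

/-- Polynomial approximation on an interval containing both spectra; compression is a contraction
and the edge algebra is closed. -/
theorem cfc_half_sub_mem {H : OpFamily Ω (BulkSite d) L} (hH : H.HasRange 1)
    (hl : H.IsBdryLocal) (hsa : IsSelfAdjoint H) {f : ℝ → ℝ} (hf : Continuous f) :
    cfc f H.half - (cfc f H).half ∈ edgeAlgebra Ω d L := by
  have hsa' : IsSelfAdjoint H.half := isSelfAdjoint_sandwich _ hsa
  refine isClosed_edgeAlgebra.closure_subset (Metric.mem_closure_iff.2 fun ε hε => ?_)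
  -- The spectrum of `A` is bounded by `‖A‖ ‖1‖`; keeping the norms of the units avoids assuming the
  -- algebras nontrivial.
  set K := max ‖H‖ ‖H.half‖ * (‖(1 : OpFamily Ω (BulkSite d) L)‖ +
    ‖(1 : OpFamily Ω (HalfSite d) L)‖) with hK
  obtain ⟨p, hp⟩ := exists_polynomial_near_of_continuousOn (-K) K f hf.continuousOn (ε / 4)
    (by positivity)
  have hspec : ∀ {ι : Type} {A : OpFamily Ω ι L}, IsSelfAdjoint A → spectrum ℝ A ⊆ Set.Icc (-K) K →
      ‖Polynomial.aeval A p - cfc f A‖ ≤ ε / 4 := fun {ι A} hA hs => by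
    rw [← cfc_polynomial p A hA, ← cfc_sub (fun x => p.eval x) f A]
    exact norm_cfc_le (by positivity) fun x hx => (hp x (hs hx)).le
  have hin : ∀ {ι : Type} {A : OpFamily Ω ι L}, ‖A‖ * ‖(1 : OpFamily Ω ι L)‖ ≤ K →
      spectrum ℝ A ⊆ Set.Icc (-K) K := fun h x hx =>
    abs_le.1 ((spectrum.norm_le_norm_mul_of_mem hx).trans h)
  have h1 := hspec hsa (hin (mul_le_mul (le_max_left _ _) (le_add_of_nonneg_right (norm_nonneg _)) (by positivity)
    (by positivity)))
  have h2 := hspec hsa' (hin (mul_le_mul (le_max_right _ _) (le_add_of_nonneg_left (norm_nonneg _)) (by positivity)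
    (by positivity)))
  refine ⟨_, half_aeval_sub_mem hH hl p, ?_⟩
  rw [dist_comm, dist_eq_norm, sub_sub_sub_comm]
  refine (norm_sub_le _ _).trans_lt ?_
  have h4 := norm_half_le (Polynomial.aeval H p - cfc f H)
  rw [half_sub] at h4
  linarith

/-- Functions of the half-space operator which vanish off a gap of the bulk spectrum belong to the
edge algebra. -/
theorem lineCfc_half_mem {H : OpFamily Ω (BulkSite d) L} (hH : H.HasRange 1)
    (hl : H.IsBdryLocal) (hsa : IsSelfAdjoint H) {s : Set ℝ}
    (hs : ∀ x ∈ s, (x : ℂ) ∉ spectrum ℂ H) {u : ℝ → ℂ} (hu : Continuous u)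
    (h0 : ∀ x ∉ s, u x = 0) : lineCfc H.half u ∈ edgeAlgebra Ω d L := by
  have hsa' : IsSelfAdjoint H.half := isSelfAdjoint_sandwich _ hsa
  have key : ∀ f : ℝ → ℝ, Continuous f → (∀ x ∉ s, f x = 0) →
      cfc f H.half ∈ edgeAlgebra Ω d L := fun f hf hf0 => by
    have h1 := cfc_half_sub_mem hH hl hsa hf
    -- In the bulk `f` vanishes on the spectrum, so the defect is all of `f(Ĥ)`.
    have h2 : cfc f H = 0 := by
      rw [cfc_congr (g := fun _ => (0 : ℝ)) fun x hx => hf0 x fun hxs => hs x hxs ?_]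
      · simp
      · exact (spectrum.algebraMap_mem_iff ℂ (r := x)).2 hx
    rwa [h2, half_zero, sub_zero] at h1
  have hre : Continuous fun x => (u x).re := Complex.continuous_re.comp hu
  have him : Continuous fun x => (u x).im := Complex.continuous_im.comp hu
  have : u = fun x => (((u x).re : ℝ) : ℂ) + Complex.I * ((u x).im : ℝ) := by
    ext x
    rw [mul_comm, Complex.re_add_im]
  rw [this, lineCfc_add hsa' (by fun_prop) (by fun_prop), lineCfc_smul _ (by fun_prop),
    lineCfc_ofReal hsa', lineCfc_ofReal hsa']
  exact add_mem (key _ hre fun x hx => by simp [h0 x hx])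
    (SMulMemClass.smul_mem _ (key _ him fun x hx => by simp [h0 x hx]))

end OpFamily

end Half

/-! ### The strip -/

section Strip

open Classical in
theorem L2.single_apply_of_ne {ι : Type*} {L : ℕ} {i j : ι} (h : j ≠ i)
    (v : EuclideanSpace ℂ (Fin L)) : (lp.single 2 i v : L2 ι L) j = 0 :=
  lp.single_apply_ne _ _ _ h

namespace OpFamily

variable {Ω : Type*} {d L N : ℕ}

/-- The projection onto the strip, in the half-space. -/
def stripProj (Ω : Type*) (d L N : ℕ) : OpFamily Ω (HalfSite d) L :=
  (1 : OpFamily Ω (StripSite d N) L).sandwich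
    (ContinuousLinearMap.adjoint (siteRestrict L (stripIncl d N)))
    (ContinuousLinearMap.adjoint (siteRestrict L (stripIncl d N)))

theorem fiber_stripProj (ω : Ω) (ψ : L2 (HalfSite d) L) :
    (stripProj Ω d L N).fiber ω ψ = ContinuousLinearMap.adjoint (siteRestrict L (stripIncl d N))
      (siteRestrict L (stripIncl d N) ψ) := by
  rw [stripProj, fiber_sandwich, ContinuousLinearMap.adjoint_adjoint, fiber_one]

theorem siteRestrict_adjoint_self {ι κ : Type*} (f : ι ↪ κ) (φ : L2 ι L) :
    siteRestrict L f (ContinuousLinearMap.adjoint (siteRestrict L f) φ) = φ :=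
  DFunLike.congr_fun (siteRestrict_comp_adjoint f) φ

theorem isIdempotentElem_stripProj : IsIdempotentElem (stripProj Ω d L N) :=
  ext_fiber fun ω ψ => by simp only [fiber_mul, fiber_stripProj, siteRestrict_adjoint_self]

theorem isSelfAdjoint_stripProj : IsSelfAdjoint (stripProj Ω d L N) :=
  isSelfAdjoint_sandwich _ (IsSelfAdjoint.one _)

theorem fiber_stripProj_apply_of_lt (ω : Ω) (ψ : L2 (HalfSite d) L) (x : BdrySite d) {k : ℕ}
    (hk : k < N) : (stripProj Ω d L N).fiber ω ψ (x, k) = ψ (x, k) := by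
  rw [fiber_stripProj]
  exact siteRestrict_adjoint_apply (stripIncl d N) _ (x, ⟨k, hk⟩)

theorem fiber_stripProj_apply_of_le (ω : Ω) (ψ : L2 (HalfSite d) L) (x : BdrySite d) {k : ℕ}
    (hk : N ≤ k) : (stripProj Ω d L N).fiber ω ψ (x, k) = 0 := by
  rw [fiber_stripProj]
  refine siteRestrict_adjoint_apply_of_notMem _ _ ?_
  rintro ⟨⟨y, l⟩, h⟩
  have : (l : ℕ) = k := congrArg Prod.snd h
  omega

theorem stripProj_mem_edgeAlgebra [TopologicalSpace Ω] [AddAction (BulkSite d) Ω] :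
    stripProj Ω d L N ∈ edgeAlgebra Ω d L := by
  classical
  have h : ∀ ω n m v, (stripProj Ω d L N).entry ω n m v = if n = m ∧ n.2 < N then v else 0 := by
    rintro ω ⟨x, k⟩ m v
    rw [entry_def]
    by_cases hk : k < N
    · rw [fiber_stripProj_apply_of_lt _ _ _ hk]
      by_cases hm : (x, k) = m
      · subst hm; simp [hk]
      · rw [if_neg fun h => hm h.1]
        exact L2.single_apply_of_ne hm v
    · rw [fiber_stripProj_apply_of_le _ _ _ (not_lt.1 hk), if_neg fun h => hk h.2]
  refine IsBdryLocal.mem_edgeAlgebra_of_rows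
    (IsLocal.diagonal (χ := fun n : HalfSite d => n.2 < N) (fun _ _ => Iff.rfl)
      fun ω n m v => by rw [h]; congr) N
    fun ω x k m v hk => ?_
  rw [h, if_neg fun h => absurd h.2 (not_lt.2 hk)]

theorem stripExtend_eq (V : OpFamily Ω (StripSite d N) L) :
    stripExtend V = 1 - stripProj Ω d L N + V.sandwich
      (ContinuousLinearMap.adjoint (siteRestrict L (stripIncl d N)))
      (ContinuousLinearMap.adjoint (siteRestrict L (stripIncl d N))) := by
  rw [stripExtend, sandwich_sub, stripProj]
  abel

theorem fiber_stripExtend (V : OpFamily Ω (StripSite d N) L) (ω : Ω) (ψ : L2 (HalfSite d) L) :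
    (stripExtend V).fiber ω ψ = ψ - (stripProj Ω d L N).fiber ω ψ +
      ContinuousLinearMap.adjoint (siteRestrict L (stripIncl d N))
        (V.fiber ω (siteRestrict L (stripIncl d N) ψ)) := by
  rw [stripExtend_eq, fiber_add, fiber_sub, fiber_one, fiber_sandwich,
    ContinuousLinearMap.adjoint_adjoint]

theorem siteRestrict_fiber_stripExtend (V : OpFamily Ω (StripSite d N) L) (ω : Ω)
    (ψ : L2 (HalfSite d) L) : siteRestrict L (stripIncl d N) ((stripExtend V).fiber ω ψ) =
      V.fiber ω (siteRestrict L (stripIncl d N) ψ) := by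
  rw [fiber_stripExtend, map_add, map_sub, fiber_stripProj, siteRestrict_adjoint_self,
    siteRestrict_adjoint_self, sub_self, zero_add]

theorem stripExtend_mul (V W : OpFamily Ω (StripSite d N) L) :
    stripExtend (V * W) = stripExtend V * stripExtend W := by
  refine ext_fiber fun ω ψ => ?_
  have h : (stripProj Ω d L N).fiber ω ((stripExtend W).fiber ω ψ) =
      ContinuousLinearMap.adjoint (siteRestrict L (stripIncl d N))
        (W.fiber ω (siteRestrict L (stripIncl d N) ψ)) := by
    rw [fiber_stripProj, siteRestrict_fiber_stripExtend]
  rw [fiber_mul, fiber_stripExtend V, h, siteRestrict_fiber_stripExtend, fiber_stripExtend W,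
    fiber_stripExtend, fiber_mul, add_sub_cancel_right]

theorem stripExtend_one : stripExtend (1 : OpFamily Ω (StripSite d N) L) = 1 := by
  rw [stripExtend_eq, ← stripProj, sub_add_cancel]

/-- Compressing the inverse of `V ⊕ 1` to the strip inverts `V`, since `V ⊕ 1` respects the
decomposition into the strip and its complement. -/
theorem isUnit_of_isUnit_stripExtend {V : OpFamily Ω (StripSite d N) L}
    (h : IsUnit (stripExtend V)) : IsUnit V := by
  obtain ⟨u, hu⟩ := h
  set y : OpFamily Ω (HalfSite d) L := (u⁻¹ : (OpFamily Ω (HalfSite d) L)ˣ).1 with hy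
  have h1 : ∀ ω ψ, (stripExtend V).fiber ω (y.fiber ω ψ) = ψ := fun ω ψ => by
    rw [← fiber_mul, ← hu, hy, u.mul_inv, fiber_one]
  have h2 : ∀ ω ψ, y.fiber ω ((stripExtend V).fiber ω ψ) = ψ := fun ω ψ => by
    rw [← fiber_mul, ← hu, hy, u.inv_mul, fiber_one]
  refine ⟨⟨V, y.sandwich (siteRestrict L (stripIncl d N)) (siteRestrict L (stripIncl d N)),
    ext_fiber fun ω φ => ?_, ext_fiber fun ω φ => ?_⟩, rfl⟩
  · rw [fiber_mul, fiber_sandwich, ← siteRestrict_fiber_stripExtend, h1, fiber_one,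
      siteRestrict_adjoint_self]
  · have : ContinuousLinearMap.adjoint (siteRestrict L (stripIncl d N)) (V.fiber ω φ) =
        (stripExtend V).fiber ω (ContinuousLinearMap.adjoint (siteRestrict L (stripIncl d N)) φ) := by
      rw [fiber_stripExtend, fiber_stripProj, siteRestrict_adjoint_self, sub_self, zero_add]
    rw [fiber_mul, fiber_sandwich, this, h2, fiber_one, siteRestrict_adjoint_self]

theorem stripExtend_ringInverse {V : OpFamily Ω (StripSite d N) L} (hV : IsUnit V)
    (h : IsUnit (stripExtend V)) : stripExtend (Ring.inverse V) = Ring.inverse (stripExtend V) := by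
  refine ((Ring.inverse_mul_eq_iff_eq_mul _ _ _ h).2 ?_).symm.trans (mul_one _)
  rw [← stripExtend_mul, Ring.mul_inverse_cancel _ hV, stripExtend_one]

/-- Brings the strip operators into the form `1 - p + prp + cp` of the abstract chain. -/
theorem stripExtend_green_add (H : OpFamily Ω (BulkSite d) L) (z c : ℂ) :
    stripExtend (greenMatrix H N z + c • 1) = 1 - stripProj Ω d L N +
      stripProj Ω d L N * Ring.inverse (H.half - z • 1) * stripProj Ω d L N +
      c • stripProj Ω d L N := by
  rw [stripExtend_eq, sandwich_add, sandwich_smul, ← stripProj, ← add_assoc]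
  congr 2
  refine ext_fiber fun ω ψ => ?_
  rw [fiber_sandwich, ContinuousLinearMap.adjoint_adjoint, greenMatrix, fiber_sandwich, fiber_mul,
    fiber_mul, fiber_stripProj, fiber_stripProj]

/-- Energies in a gap of the bulk are controlled by the strip. -/
theorem exists_norm_le_strip {H : OpFamily Ω (BulkSite d) L} (hH : H.HasRange 1) {z : ℂ}
    (hz : z ∉ spectrum ℂ H) (hN : 1 ≤ N) :
    ∃ C > 0, ∀ ω ψ, ‖ψ‖ ≤
      C * (‖(H.half - z • 1).fiber ω ψ‖ + ‖(stripProj Ω d L N).fiber ω ψ‖) := by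
  have hu : IsUnit (H - z • 1) := by
    rw [spectrum.notMem_iff, Algebra.algebraMap_eq_smul_one] at hz
    rwa [← neg_sub, IsUnit.neg_iff]
  obtain ⟨C, hC, hle⟩ := exists_norm_le_of_isUnit hu
  refine ⟨C * (1 + 2 * ‖H‖), by positivity, fun ω ψ => ?_⟩
  set S := siteRestrict L (halfIncl d) with hS
  set S' := ContinuousLinearMap.adjoint S with hS'
  set φ := (stripProj Ω d L N).fiber ω ψ with hφ
  -- As `N ≥ 1`, the vector `ψ - φ` lives in layers `≥ 2`, and a nearest neighbor operator cannot
  -- take it to layers `≤ 0`.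
  have key : H.fiber ω (S' (ψ - φ)) = S' (S (H.fiber ω (S' (ψ - φ)))) := by
    ext r : 2
    by_cases hr : r ∈ Set.range (halfIncl d)
    · obtain ⟨s, rfl⟩ := hr
      rw [hS', siteRestrict_adjoint_apply, siteRestrict_apply]
    · rw [hS', siteRestrict_adjoint_apply_of_notMem _ _ hr]
      refine fiber_apply_eq_zero _ _ _ _ fun t => ?_
      by_cases ht : t ∈ Set.range (halfIncl d)
      · obtain ⟨⟨y, l⟩, rfl⟩ := ht
        rw [siteRestrict_adjoint_apply]
        rcases Nat.lt_or_ge l N with hl | hl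
        · rw [lp.coeFn_sub, Pi.sub_apply, hφ, fiber_stripProj_apply_of_lt _ _ _ hl, sub_self,
            entry_zero_right]
        · refine hH _ _ _ _ (lt_of_lt_of_le ?_ (le_max_right _ _))
          have h1 := mem_range_halfIncl hr
          change (1 : ℝ) < dist r.2 ((l : ℤ) + 1)
          rw [dist_comm, Int.dist_eq]
          refine lt_of_lt_of_le ?_ (le_abs_self _)
          have : (2 : ℤ) ≤ (l : ℤ) + 1 - r.2 := by omega
          have : ((2 : ℤ) : ℝ) ≤ (((l : ℤ) + 1 - r.2 : ℤ) : ℝ) := by exact_mod_cast this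
          push_cast at this ⊢
          linarith
      · rw [siteRestrict_adjoint_apply_of_notMem _ _ ht, entry_zero_right]
  -- Only the strip part `φ` leaks across the boundary, at a cost of at most `2‖H‖ ‖φ‖`; this is the
  -- source of the factor `1 + 2‖H‖`.
  have hdec : (H - z • 1).fiber ω (S' ψ) = S' ((H.half - z • 1).fiber ω ψ) +
      (H.fiber ω (S' φ) - S' (S (H.fiber ω (S' φ)))) := by
    have e : H.fiber ω (S' ψ) = S' (S (H.fiber ω (S' ψ))) +
        (H.fiber ω (S' φ) - S' (S (H.fiber ω (S' φ)))) := by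
      simp only [map_sub] at key
      rw [sub_eq_iff_eq_add] at key
      rw [key]
      simp only [map_add, map_sub]
      rw [hS', hS]
      simp only [siteRestrict_adjoint_self]
      abel
    have e2 : (H.half - z • 1).fiber ω ψ = S (H.fiber ω (S' ψ)) - z • ψ := rfl
    have e3 : (H - z • 1).fiber ω (S' ψ) = H.fiber ω (S' ψ) - z • S' ψ := rfl
    rw [e2, e3, map_sub, map_smul]
    rw [e]
    simp only [map_add, map_sub]
    rw [hS', hS]
    simp only [siteRestrict_adjoint_self]
    abel
  have h1 : ‖H.fiber ω (S' φ)‖ ≤ ‖H‖ * ‖φ‖ := by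
    refine (norm_fiber_apply_le _ _ _).trans_eq ?_
    rw [hS', norm_siteRestrict_adjoint_apply]
  have h2 : ‖S' (S (H.fiber ω (S' φ)))‖ ≤ ‖H‖ * ‖φ‖ := by
    rw [hS', norm_siteRestrict_adjoint_apply]
    exact (norm_siteRestrict_apply_le _ _).trans h1
  have h3 : ‖(H - z • 1).fiber ω (S' ψ)‖ ≤
      ‖(H.half - z • 1).fiber ω ψ‖ + (‖H‖ * ‖φ‖ + ‖H‖ * ‖φ‖) := by
    rw [hdec]
    refine (norm_add_le _ _).trans (add_le_add ?_ ((norm_sub_le _ _).trans (add_le_add h1 h2)))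
    rw [hS', norm_siteRestrict_adjoint_apply]
  have h4 := hle ω (S' ψ)
  rw [hS', norm_siteRestrict_adjoint_apply, ← hS'] at h4
  refine h4.trans ?_
  rw [mul_assoc]
  refine mul_le_mul_of_nonneg_left (h3.trans ?_) hC.le
  have := norm_nonneg H
  have := norm_nonneg φ
  have := norm_nonneg ((H.half - z • 1).fiber ω ψ)
  nlinarith [mul_nonneg (norm_nonneg H) (norm_nonneg ((H.half - z • 1).fiber ω ψ))]

theorem re_inner_stripProj (ω : Ω) (ψ : L2 (HalfSite d) L) :
    (inner ℂ ψ ((stripProj Ω d L N).fiber ω ψ)).re = ‖(stripProj Ω d L N).fiber ω ψ‖ ^ 2 := by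
  have h := inner_fiber_of_isSelfAdjoint (isSelfAdjoint_stripProj (Ω := Ω) (d := d) (L := L)
    (N := N)) ω ψ ((stripProj Ω d L N).fiber ω ψ)
  rw [← fiber_mul, isIdempotentElem_stripProj.eq, inner_self_eq_norm_sq_to_K] at h
  rw [← h]
  norm_cast

/-- The form bound `x² + P ≥ c` for `x = Ĥ - μ` and the projection `P` onto the strip. -/
theorem exists_form_bound_strip {H : OpFamily Ω (BulkSite d) L} (hH : H.HasRange 1) {z : ℂ}
    (hz : z ∉ spectrum ℂ H) (hN : 1 ≤ N) :
    ∃ c > 0, ∀ ω ψ, c * ‖ψ‖ ^ 2 ≤ ‖(H.half - z • 1).fiber ω ψ‖ ^ 2 +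
      (inner ℂ ψ ((stripProj Ω d L N).fiber ω ψ)).re := by
  obtain ⟨C, hC, hle⟩ := exists_norm_le_strip hH hz hN
  refine ⟨(2 * C ^ 2)⁻¹, by positivity, fun ω ψ => ?_⟩
  rw [re_inner_stripProj, inv_mul_le_iff₀ (by positivity)]
  refine (pow_le_pow_left₀ (norm_nonneg _) (hle ω ψ) 2).trans ?_
  rw [mul_pow, mul_comm 2, mul_assoc]
  refine mul_le_mul_of_nonneg_left ?_ (by positivity)
  nlinarith [sq_nonneg (‖(H.half - z • 1).fiber ω ψ‖ - ‖(stripProj Ω d L N).fiber ω ψ‖)]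

end OpFamily

end Strip

/-! ### Invertibility along the paths, from the bulk gap -/

section Main

namespace OpFamily

variable {Ω ι : Type*} {d L N : ℕ}

theorem re_inner_mul_self {A : OpFamily Ω ι L} (hA : IsSelfAdjoint A) (ω : Ω) (ψ : L2 ι L) :
    (inner ℂ ψ ((A * A).fiber ω ψ)).re = ‖A.fiber ω ψ‖ ^ 2 := by
  rw [fiber_mul, ← inner_fiber_of_isSelfAdjoint hA, inner_self_eq_norm_sq_to_K]
  norm_cast

theorem re_inner_cfc_nonneg (A : OpFamily Ω ι L) {f : ℝ → ℝ}
    (hf : Continuous f) (h0 : ∀ x, 0 ≤ f x) (ω : Ω) (ψ : L2 ι L) :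
    0 ≤ (inner ℂ ψ ((cfc f A).fiber ω ψ)).re := by
  have h : cfc f A = cfc (fun x => √(f x)) A * cfc (fun x => √(f x)) A := by
    rw [← cfc_mul (fun x => √(f x)) (fun x => √(f x)) A]
    simp only [Real.mul_self_sqrt (h0 _)]
  have hs : IsSelfAdjoint (cfc (fun x => √(f x)) A) := cfc_predicate _ _
  rw [h, re_inner_mul_self hs]
  positivity

theorem isSelfAdjoint_sub_smul_one {A : OpFamily Ω ι L} (hA : IsSelfAdjoint A) (μ : ℝ) :
    IsSelfAdjoint (A - (μ : ℂ) • (1 : OpFamily Ω ι L)) :=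
  hA.sub (IsSelfAdjoint.smul (by simp [isSelfAdjoint_iff]) (IsSelfAdjoint.one _))

/-- The form bound `x² + χ(h) ≥ c` for `x = h - μ` and the parabola `χ` over a gap around `μ`. -/
theorem form_bound_gapBump {A : OpFamily Ω ι L} (hA : IsSelfAdjoint A) {a b μ : ℝ} (haμ : a < μ)
    (hμb : μ < b) (ω : Ω) (ψ : L2 ι L) :
    min ((a - μ) ^ 2) ((b - μ) ^ 2) * ‖ψ‖ ^ 2 ≤ ‖(A - (μ : ℂ) • 1).fiber ω ψ‖ ^ 2 +
      (inner ℂ ψ ((cfc (gapBump a b) A).fiber ω ψ)).re := by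
  set c := min ((a - μ) ^ 2) ((b - μ) ^ 2) with hc
  have hχ := continuous_gapBump a b
  have hca : c ≤ (a - μ) ^ 2 := min_le_left _ _
  have hcb : c ≤ (b - μ) ^ 2 := min_le_right _ _
  -- In the gap the squares cancel and `(x - μ)² + (x - a)(b - x)` is affine in `x`, with values `(a
  -- - μ)²` and `(b - μ)²` at the ends. This is what the parabola is chosen for.
  have h0 : ∀ x, 0 ≤ (x - μ) * (x - μ) + gapBump a b x - c := fun x => by
    by_cases hx : x ∈ Set.Ioo a b
    · obtain ⟨h1, h2⟩ := hx
      have h3 : (x - a) * (b - x) ≤ gapBump a b x := le_max_right _ _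
      have h4 : 0 ≤ (x - a) * ((b - μ) ^ 2 - c) := mul_nonneg (by linarith) (by linarith)
      have h5 : 0 ≤ (b - x) * ((a - μ) ^ 2 - c) := mul_nonneg (by linarith) (by linarith)
      have h6 : 0 ≤ (b - a) * ((x - μ) * (x - μ) + (x - a) * (b - x) - c) := by linarith
      have := nonneg_of_mul_nonneg_right h6 (by linarith)
      linarith
    · have h3 := gapBump_nonneg a b x
      by_cases h : x ≤ a
      · nlinarith
      · have : b ≤ x := not_lt.1 fun h' => hx ⟨not_le.1 h, h'⟩
        nlinarith
  have hxs : IsSelfAdjoint (A - (μ : ℂ) • (1 : OpFamily Ω ι L)) :=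
    isSelfAdjoint_sub_smul_one hA μ
  have hcfc : cfc (fun x => (x - μ) * (x - μ) + gapBump a b x - c) A =
      (A - (μ : ℂ) • 1) * (A - (μ : ℂ) • 1) + cfc (gapBump a b) A - (c : ℂ) • 1 := by
    refine (lineCfc_ofReal hA _).symm.trans ?_
    have e : cfc (gapBump a b) A = lineCfc A fun x => (gapBump a b x : ℂ) :=
      (lineCfc_ofReal hA _).symm
    rw [e]
    simp only [Complex.ofReal_sub, Complex.ofReal_add, Complex.ofReal_mul]
    rw [lineCfc_sub hA (by fun_prop) (by fun_prop), lineCfc_add hA (by fun_prop) (by fun_prop),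
      lineCfc_mul hA (by fun_prop) (by fun_prop), lineCfc_sub hA (by fun_prop) (by fun_prop),
      lineCfc_id hA, lineCfc_const hA, lineCfc_const hA]
  have h := re_inner_cfc_nonneg A (by fun_prop) h0 ω ψ
  rw [hcfc, fiber_sub, fiber_add, fiber_smul, fiber_one, inner_sub_right, inner_add_right,
    inner_smul_right, Complex.sub_re, Complex.add_re, Complex.re_ofReal_mul,
    re_inner_mul_self hxs] at h
  have h1 : (inner ℂ ψ ψ).re = ‖ψ‖ ^ 2 := by
    rw [inner_self_eq_norm_sq_to_K]; norm_cast
  rw [h1] at h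
  linarith

/-- `Ĥ - μ + i P` is invertible for `μ` in a gap of the bulk. -/
theorem isUnit_half_add_stripProj {H : OpFamily Ω (BulkSite d) L} (hH : H.HasRange 1)
    (hsa : IsSelfAdjoint H) {μ : ℝ} (hμ : (μ : ℂ) ∉ spectrum ℂ H) (hN : 1 ≤ N) :
    IsUnit (H.half - (μ : ℂ) • 1 + Complex.I • stripProj Ω d L N) := by
  obtain ⟨c, hc, h⟩ := exists_form_bound_strip hH hμ hN
  exact isUnit_add_I_smul (isSelfAdjoint_sub_smul_one (isSelfAdjoint_sandwich _ hsa) μ)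
    isSelfAdjoint_stripProj hc (fun ω ψ => by rw [re_inner_stripProj]; positivity) h

/-- Here `-is` and `-ip` have the same sign: up to a global sign the operator is `-(Ĥ - μ) + i(p +
s)` with `p + s ≥ p`, so every `s ≥ 0` is allowed. With `+ip` the signs compete, and small `δ` is
needed. -/
theorem isUnit_half_sub_stripProj {H : OpFamily Ω (BulkSite d) L} (hH : H.HasRange 1)
    (hsa : IsSelfAdjoint H) {μ : ℝ} (hμ : (μ : ℂ) ∉ spectrum ℂ H) (hN : 1 ≤ N) {s : ℝ}
    (hs : 0 ≤ s) :
    IsUnit (H.half - (μ + s * Complex.I : ℂ) • 1 - Complex.I • stripProj Ω d L N) := by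
  obtain ⟨c, hc, h⟩ := exists_form_bound_strip hH hμ hN
  have hQ : ∀ ω (ψ : L2 (HalfSite d) L),
      (inner ℂ ψ ((stripProj Ω d L N + (s : ℂ) • 1).fiber ω ψ)).re =
        (inner ℂ ψ ((stripProj Ω d L N).fiber ω ψ)).re + s * ‖ψ‖ ^ 2 := fun ω ψ => by
    rw [fiber_add, fiber_smul, fiber_one, inner_add_right, inner_smul_right, Complex.add_re,
      Complex.re_ofReal_mul, inner_self_eq_norm_sq_to_K]
    norm_cast
  have hu := isUnit_add_I_smul
    (x := -(H.half - (μ : ℂ) • 1)) (Q := stripProj Ω d L N + (s : ℂ) • 1)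
    (isSelfAdjoint_sub_smul_one (isSelfAdjoint_sandwich _ hsa) μ).neg
    (isSelfAdjoint_stripProj.add (IsSelfAdjoint.smul (by simp [isSelfAdjoint_iff])
      (IsSelfAdjoint.one _))) hc
    (fun ω ψ => by rw [hQ, re_inner_stripProj]; positivity)
    (fun ω ψ => by
      have h1 : ‖(-(H.half - (μ : ℂ) • 1)).fiber ω ψ‖ = ‖(H.half - (μ : ℂ) • 1).fiber ω ψ‖ :=
        norm_neg _
      have h2 : 0 ≤ s * ‖ψ‖ ^ 2 := by positivity
      rw [hQ, h1]
      linarith [h ω ψ])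
  rw [← IsUnit.neg_iff]
  convert hu using 1
  module

/-- `Ĥ - μ + i Q` is invertible for `Q` between the projection onto the strip and `χ(Ĥ)`. -/
theorem isUnit_half_add_convex {H : OpFamily Ω (BulkSite d) L} (hH : H.HasRange 1)
    (hsa : IsSelfAdjoint H) {a b μ : ℝ} (haμ : a < μ) (hμb : μ < b)
    (hμ : (μ : ℂ) ∉ spectrum ℂ H) (hN : 1 ≤ N) {t : ℝ} (ht : t ∈ Set.Icc (0 : ℝ) 1) :
    IsUnit (H.half - (μ : ℂ) • 1 + Complex.I •
      (((1 - t : ℝ) : ℂ) • stripProj Ω d L N + (t : ℂ) • cfc (gapBump a b) H.half)) := by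
  obtain ⟨c, hc, h⟩ := exists_form_bound_strip hH hμ hN
  have hsa' : IsSelfAdjoint H.half := isSelfAdjoint_sandwich _ hsa
  obtain ⟨ht0, ht1⟩ := ht
  have ht1' : 0 ≤ 1 - t := by linarith
  have hχ0 := re_inner_cfc_nonneg H.half (continuous_gapBump a b) (gapBump_nonneg a b)
  have hQ : ∀ ω (ψ : L2 (HalfSite d) L), (inner ℂ ψ ((((1 - t : ℝ) : ℂ) • stripProj Ω d L N +
      (t : ℂ) • cfc (gapBump a b) H.half).fiber ω ψ)).re =
        (1 - t) * (inner ℂ ψ ((stripProj Ω d L N).fiber ω ψ)).re +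
          t * (inner ℂ ψ ((cfc (gapBump a b) H.half).fiber ω ψ)).re := fun ω ψ => by
    rw [fiber_add, fiber_smul, fiber_smul, inner_add_right, inner_smul_right, inner_smul_right,
      Complex.add_re, Complex.re_ofReal_mul, Complex.re_ofReal_mul]
  have hc' : 0 < min ((a - μ) ^ 2) ((b - μ) ^ 2) := lt_min
    (sq_pos_of_neg (sub_neg.2 haμ)) (pow_pos (sub_pos.2 hμb) 2)
  refine isUnit_add_I_smul (c := min c (min ((a - μ) ^ 2) ((b - μ) ^ 2)))
    (isSelfAdjoint_sub_smul_one hsa' μ)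
    ((IsSelfAdjoint.smul (by simp [isSelfAdjoint_iff]) isSelfAdjoint_stripProj).add
      (IsSelfAdjoint.smul (by simp [isSelfAdjoint_iff]) (cfc_predicate _ _)))
    (lt_min hc hc') (fun ω ψ => ?_) (fun ω ψ => ?_)
  · rw [hQ, re_inner_stripProj]
    have := hχ0 ω ψ
    positivity
  · rw [hQ]
    have h1 := h ω ψ
    have h2 := form_bound_gapBump hsa' haμ hμb ω ψ
    set m := min c (min ((a - μ) ^ 2) ((b - μ) ^ 2)) with hm
    have h3 : m * ‖ψ‖ ^ 2 ≤ c * ‖ψ‖ ^ 2 := by gcongr; exact min_le_left _ _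
    have h4 : m * ‖ψ‖ ^ 2 ≤ min ((a - μ) ^ 2) ((b - μ) ^ 2) * ‖ψ‖ ^ 2 := by
      gcongr; exact min_le_right _ _
    have h5 := mul_le_mul_of_nonneg_left (h3.trans h1) ht1'
    have h6 := mul_le_mul_of_nonneg_left (h4.trans h2) ht0
    linarith

end OpFamily

end Main

end Families

/-! ### The main theorem -/

set_option maxHeartbeats 1000000 in
open OpFamily in
theorem mainTheorem5 {d L : ℕ} (hd : 1 ≤ d) {Ω : Type*} [TopologicalSpace Ω] [CompactSpace Ω]
    [AddAction (BulkSite d) Ω] [ContinuousConstVAdd (BulkSite d) Ω]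
    (H₀ H₁ : OpFamily Ω (BulkSite d) L)
    (hA₀ : H₀ ∈ bulkAlgebra Ω d L) (hA₁ : H₁ ∈ bulkAlgebra Ω d L)
    (hsa₀ : IsSelfAdjoint H₀) (hsa₁ : IsSelfAdjoint H₁)
    (hnn₀ : H₀.HasRange 1) (hnn₁ : H₁.HasRange 1)
    (hinv : ∀ n : ℤ, IsUnit (H₀.hopping n))
    (hper : H₀.PeriodicAlongBdry)
    (μ : ℝ) (hμ : (μ : ℂ) ∉ spectrum ℂ H₀) (N : ℕ) (hN : 1 ≤ N) :
    ∃ δ₀ > (0 : ℝ), ∃ lam₀ > (0 : ℝ), ∀ δ : ℝ, 0 < δ → δ < δ₀ → ∀ lam : ℝ, |lam| < lam₀ →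
      (μ : ℂ) ∉ spectrum ℂ (H₀ + (lam : ℂ) • H₁) ∧
      IsUnit (greenMatrix (H₀ + (lam : ℂ) • H₁) N (μ + δ * Complex.I) + Complex.I • 1) ∧
      IsUnit (cayleyGreen (H₀ + (lam : ℂ) • H₁) N (μ + δ * Complex.I)) ∧
      ∀ f : ℝ → ℝ, IsGapSwitch (H₀ + (lam : ℂ) • H₁) μ f →
        ∃ U V : (edgeUnitization Ω d L)ˣ,
          (U : OpFamily Ω (HalfSite d) L) = expBoundary (H₀ + (lam : ℂ) • H₁) f ∧
          (V : OpFamily Ω (HalfSite d) L) =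
            stripExtend (cayleyGreen (H₀ + (lam : ℂ) • H₁) N (μ + δ * Complex.I)) ∧
          KOne.mk (A := edgeUnitization Ω d L) U = -KOne.mk (A := edgeUnitization Ω d L) V := by
  have hnotMem : ∀ A : OpFamily Ω (BulkSite d) L,
      (μ : ℂ) ∉ spectrum ℂ A ↔ IsUnit (A - (μ : ℂ) • 1) := fun A => by
    rw [spectrum.notMem_iff, Algebra.algebraMap_eq_smul_one, ← neg_sub, IsUnit.neg_iff]
  obtain ⟨ε₁, hε₁, hball₁⟩ := Metric.isOpen_iff.1 Units.isOpen _ ((hnotMem H₀).1 hμ)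
  obtain ⟨ε₂, hε₂, hball₂⟩ := Metric.isOpen_iff.1 Units.isOpen _
    (isUnit_half_add_stripProj hnn₀ hsa₀ hμ hN)
  set e := ‖(1 : OpFamily Ω (HalfSite d) L)‖ with he
  have he0 : 0 ≤ e := norm_nonneg _
  -- `|λ| ‖H₁‖ < ε₁` keeps `μ` off the bulk spectrum; `|λ| ‖H₁‖ < ε₂/2` and `δ ‖1‖ < ε₂/2` keep `Ĥ -
  -- μ - itδ + ip` in the second ball of invertibles. The added ones avoid division by zero.
  refine ⟨ε₂ / (2 * (e + 1)), by positivity, min (ε₁ / (‖H₁‖ + 1)) (ε₂ / (2 * (‖H₁‖ + 1))),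
    lt_min (by positivity) (by positivity), fun δ hδ hδ₀ lam hlam => ?_⟩
  have hlam₁ := (lt_div_iff₀ (by positivity)).1 (hlam.trans_le (min_le_left _ _))
  have hlam₂ := (lt_div_iff₀ (by positivity)).1 (hlam.trans_le (min_le_right _ _))
  have hδ₁ := (lt_div_iff₀ (by positivity)).1 hδ₀
  have hlam₀ := abs_nonneg lam
  set H := H₀ + (lam : ℂ) • H₁ with hHdef
  have hA : H ∈ bulkAlgebra Ω d L := add_mem hA₀ (SMulMemClass.smul_mem _ hA₁)
  have hsa : IsSelfAdjoint H := hsa₀.add (IsSelfAdjoint.smul (by simp [isSelfAdjoint_iff]) hsa₁)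
  have hnn : H.HasRange 1 := fun ω n m v hd => by
    rw [hHdef, entry_add, entry_smul, hnn₀ _ _ _ _ hd, hnn₁ _ _ _ _ hd, smul_zero, add_zero]
  have hl := isBdryLocal_of_mem_bulkAlgebra hA hnn
  have hsa' : IsSelfAdjoint H.half := isSelfAdjoint_sandwich _ hsa
  have hHμ : (μ : ℂ) ∉ spectrum ℂ H := by
    refine (hnotMem H).2 (hball₁ ?_)
    have : H - (μ : ℂ) • 1 - (H₀ - (μ : ℂ) • 1) = (lam : ℂ) • H₁ := by rw [hHdef]; abel
    rw [Metric.mem_ball, dist_eq_norm, this, norm_smul, Complex.norm_real, Real.norm_eq_abs]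
    linarith
  have hx : ∀ t ∈ Set.Icc (0 : ℝ) 1, IsUnit
      (H.half - (μ + (t * δ : ℝ) * Complex.I : ℂ) • 1 + Complex.I • stripProj Ω d L N) :=
    fun t ht => by
      refine hball₂ ?_
      have : H.half - (μ + (t * δ : ℝ) * Complex.I : ℂ) • 1 + Complex.I • stripProj Ω d L N -
          (H₀.half - (μ : ℂ) • 1 + Complex.I • stripProj Ω d L N) =
          (lam : ℂ) • H₁.half - ((t * δ : ℝ) * Complex.I : ℂ) • 1 := by
        rw [hHdef, half_add, half_smul, add_smul]
        abel
      rw [Metric.mem_ball, dist_eq_norm, this]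
      refine (norm_sub_le _ _).trans_lt ?_
      rw [norm_smul, norm_smul, norm_mul, Complex.norm_I, Complex.norm_real, Complex.norm_real,
        Real.norm_eq_abs, Real.norm_eq_abs, mul_one, ← he, abs_of_nonneg (mul_nonneg ht.1 hδ.le)]
      have h1 : |lam| * ‖H₁.half‖ ≤ |lam| * ‖H₁‖ := by gcongr; exact norm_half_le H₁
      have h2 : t * δ * e ≤ δ * e := by
        gcongr
        exact mul_le_of_le_one_left hδ.le ht.2
      linarith
  have hy : ∀ t ∈ Set.Icc (0 : ℝ) 1, IsUnit
      (H.half - (μ + (t * δ : ℝ) * Complex.I : ℂ) • 1 - Complex.I • stripProj Ω d L N) :=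
    fun t ht => isUnit_half_sub_stripProj hnn hsa hHμ hN (mul_nonneg ht.1 hδ.le)
  have hz : IsUnit (H.half - (μ + δ * Complex.I : ℂ) • 1) :=
    hsa'.isUnit_sub_smul_one (by simpa using hδ.ne')
  have hx1 : IsUnit (H.half - (μ + δ * Complex.I : ℂ) • 1 + Complex.I • stripProj Ω d L N) := by
    simpa only [one_mul] using hx 1 (by simp)
  have hy1 : IsUnit (H.half - (μ + δ * Complex.I : ℂ) • 1 - Complex.I • stripProj Ω d L N) := by
    simpa only [one_mul] using hy 1 (by simp)
  -- The signs cross over: `G + i` is governed by `Ĥ - z - ip` and `G - i` by `Ĥ - z + ip`, because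
  -- `c d = -1` forces `d = c` for `c = ±i`.
  have hplus : IsUnit (stripExtend (greenMatrix H N (μ + δ * Complex.I) + Complex.I • 1)) := by
    rw [stripExtend_green_add]
    exact isUnit_compression_add isIdempotentElem_stripProj Complex.I_mul_I hz hy1
  have hsub : greenMatrix H N (μ + δ * Complex.I) - Complex.I • 1 =
      greenMatrix H N (μ + δ * Complex.I) + (-Complex.I) • 1 := by
    rw [neg_smul, sub_eq_add_neg]
  have hminus : IsUnit (stripExtend (greenMatrix H N (μ + δ * Complex.I) - Complex.I • 1)) := by
    rw [hsub, stripExtend_green_add]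
    exact isUnit_compression_add isIdempotentElem_stripProj (d := -Complex.I) (by simp) hz
      (by rwa [neg_smul, sub_neg_eq_add])
  have hplus' := isUnit_of_isUnit_stripExtend hplus
  refine ⟨hHμ, hplus', (isUnit_of_isUnit_stripExtend hminus).mul hplus'.ringInverse, ?_⟩
  rintro f ⟨hfs, hfm, a, b, haμ, hμb, hgap, hfa, hfb⟩
  have key := exists_kOne_exp_eq_neg_cayley isClosed_edgeAlgebra hsa' hl.half.mem_idealizer
    isIdempotentElem_stripProj isSelfAdjoint_stripProj (stripProj_mem_edgeAlgebra (N := N)) hδ haμ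
    hμb (fun u hu h0 => lineCfc_half_mem hnn hl hsa hgap hu h0) hx hy
    (fun t ht => isUnit_half_add_convex hnn hsa haμ hμb hHμ hN ht) hfs.continuous
    -- Monotonicity gives `0 ≤ f ≤ 1`, by comparison with the values at `min x a` and `max x b`.
    (fun x => (hfa _ (min_le_right x a)).symm.le.trans (hfm (min_le_left x a)))
    (fun x => (hfm (le_max_left x b)).trans (hfb _ (le_max_right x b)).le) hfa hfb
  rw [cayleyGreen, stripExtend_mul, stripExtend_ringInverse hplus' hplus, stripExtend_green_add,
    hsub, stripExtend_green_add, neg_smul, ← sub_eq_add_neg]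
  exact key

end
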